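/- **Theorem (Asymptotic normality of the emulator-based estimator).** *Model.* Let $f$ be a probability density on $\mathbb{R}^K$ with exchangeable coordinates and let $\epsilon^*$ have density $f$. For $v\in\mathbb{R}^K$ and a positive semidefinite $K\times K$ matrix $\Sigma$, put $U_j=v_j+(\Sigma^{1/2}\epsilon^*)_j$, with $\Sigma^{1/2}$ the positive semidefinite square root, and $P_j(v,\Sigma)=\Pr(U_j\ge U_k\text{ for all }k\ne j)$. Let $\Theta\subset\mathbb{R}^p$, let $(X,\theta)\mapsto v^*(X,\theta)\in\mathbb{R}^K$ and $(X,\theta)\mapsto\Sigma^*(X,\theta)$ (positive semidefinite) be given, and suppose that for all $X$ and all $\theta\in\Theta$ the utilities at $(v^*(X,\theta),\Sigma^*(X,\theta))$ are almost surely pairwise distinct and all choice probabilities are positive and measurable in $X$. Put $$m(y,X;\theta)=\log P_y\{v^*(X,\theta),\Sigma^*(X,\theta)\},\qquad \psi=\nabla_\theta m .$$ Let $(y_i,X_i)$, $i\ge1$, be i.i.d. from the model with parameter $\theta_0$: $X_i$ has some law $Q$ and $\Pr(y_i=j\mid X_i)=P_j\{v^*(X_i,\theta_0),\Sigma^*(X_i,\theta_0)\}$.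 Let $\ell_n(\theta)=\frac1n\sum_{i=1}^n m(y_i,X_i;\theta)$. *Emulator.* Let $\hat P_j(v,\Sigma;\phi)>0$ be any emulator of the choice probabilities with weights $\phi$, let $\phi_n$ be (possibly random) weights, and let $\hat\ell_n(\theta)=\frac1n\sum_{i=1}^n\log\hat P_{y_i}\{v^*(X_i,\theta),\Sigma^*(X_i,\theta);\phi_n\}$. Let $\hat\theta_n$ be a random vector in $\Theta$ that maximizes $\hat\ell_n$ over $\Theta$, exactly or up to an error $o_p(n^{-1})$, i.e. $\hat\ell_n(\hat\theta_n)\ge\sup_{\theta\in\Theta}\hat\ell_n(\theta)-o_p(n^{-1})$. *Assumptions.* 1. For some $\alpha\ge1$, $\ \sup_{\theta\in\Theta}|\hat\ell_n(\theta)-\ell_n(\theta)|=o_p(n^{-\alpha})$. 2. (i) $\Theta$ is compact, $\theta_0\in\mathrm{int}(\Theta)$ is the unique maximizer over $\Theta$ of $\mathbb{E}\{m(y,X;\theta)\}\in[-\infty,0]$, and $\mathbb{E}|m(y,X;\theta_0)|<\infty$; (ii) for all $(y,X)$, $m(y,X;\cdot)$ is continuous on $\Theta$ and twice continuously differentiable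 in $\mathrm{int}(\Theta)$; (iii) $\mathbb{E}\{\sup_{\theta\in\mathrm{int}(\Theta)}\|\psi(y,X;\theta)\|^2\}<\infty$; (iv) $\mathbb{E}\{\sup_{\theta\in\mathrm{int}(\Theta)}\|\nabla_\theta^2m(y,X;\theta)\|\}<\infty$; (v) $J(\theta_0)=\mathbb{E}\{\psi(y,X;\theta_0)\psi(y,X;\theta_0)^\top\}$ is positive definite. *Conclusion.* As $n\to\infty$, $$\sqrt n(\hat\theta_n-\theta_0)\xrightarrow{d}\mathcal{N}\{0,J(\theta_0)^{-1}\}.$$ -/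

import Mathlib

open MeasureTheory ProbabilityTheory Filter Topology
open scoped ENNReal MatrixOrder Gradient

noncomputable section

/-- The law on `ℝ^K` with Lebesgue density `f`. -/
def errorLaw {K : ℕ} (f : (Fin K → ℝ) → ℝ) : Measure (Fin K → ℝ) :=
  volume.withDensity fun e => ENNReal.ofReal (f e)

/-- `f` is a probability density on `ℝ^K` with exchangeable coordinates. -/
structure IsErrorDensity {K : ℕ} (f : (Fin K → ℝ) → ℝ) : Prop where
  measurable : Measurable f
  nonneg : ∀ e, 0 ≤ f e
  lintegral_eq_one : ∫⁻ e, ENNReal.ofReal (f e) = 1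
  exchangeable : ∀ (π : Equiv.Perm (Fin K)) (e : Fin K → ℝ), f (fun j => e (π j)) = f e

/-- The latent utilities `U_j = v_j + ε_j` with `ε = Σ^{1/2} ε*`, where `S = Σ` and `e = ε*`. The
root is the positive semidefinite one. -/
def latentUtility {K : ℕ} (v : Fin K → ℝ) (S : Matrix (Fin K) (Fin K) ℝ) (e : Fin K → ℝ)
    (j : Fin K) : ℝ :=
  v j + (CFC.sqrt S).mulVec e j

/-- The choice probability `P_j(v, Σ) = Pr(U_j ≥ U_k for all k ≠ j)`. -/
def choiceProb {K : ℕ} (f : (Fin K → ℝ) → ℝ) (v : Fin K → ℝ) (S : Matrix (Fin K) (Fin K) ℝ)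
    (j : Fin K) : ℝ :=
  (errorLaw f).real {e | ∀ k, k ≠ j → latentUtility v S e k ≤ latentUtility v S e j}

/-- A parametric discrete choice model with `K` alternatives, covariates in `𝒳` and a parameter
in `ℝ^p`: the density of `ε*` and the maps `(X, θ) ↦ v*(X, θ)` and `(X, θ) ↦ Σ*(X, θ)`. -/
structure ChoiceModel (K p : ℕ) (𝒳 : Type*) where
  errorDensity : (Fin K → ℝ) → ℝ
  utility : 𝒳 → EuclideanSpace ℝ (Fin p) → Fin K → ℝ
  scale : 𝒳 → EuclideanSpace ℝ (Fin p) → Matrix (Fin K) (Fin K) ℝ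

namespace ChoiceModel

variable {K p : ℕ} {𝒳 : Type*}

/-- The probability of alternative `j` given covariates `x`, at the parameter `θ`. -/
def prob (M : ChoiceModel K p 𝒳) (x : 𝒳) (θ : EuclideanSpace ℝ (Fin p)) (j : Fin K) : ℝ :=
  choiceProb M.errorDensity (M.utility x θ) (M.scale x θ) j

/-- The log-likelihood contribution `m(y, X; θ)` of the observation `z = (X, y)`. -/
def logLik (M : ChoiceModel K p 𝒳) (z : 𝒳 × Fin K) (θ : EuclideanSpace ℝ (Fin p)) : ℝ :=
  Real.log (M.prob z.1 θ z.2)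

/-- The score `ψ(y, X; θ)`, the gradient of `m` in `θ`. -/
def score (M : ChoiceModel K p 𝒳) (z : 𝒳 × Fin K) (θ : EuclideanSpace ℝ (Fin p)) :
    EuclideanSpace ℝ (Fin p) :=
  ∇ (M.logLik z) θ

/-- The Hessian of `m` in `θ`, as an operator on `ℝ^p`. -/
def hessian (M : ChoiceModel K p 𝒳) (z : 𝒳 × Fin K) (θ : EuclideanSpace ℝ (Fin p)) :
    EuclideanSpace ℝ (Fin p) →L[ℝ] EuclideanSpace ℝ (Fin p) :=
  fderiv ℝ (M.score z) θ

/-- The model makes sense on the parameter set `Θ`: the errors have an exchangeable density, the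
scale matrices are positive semidefinite, ties between utilities have probability zero (so that
the choice `argmax_j U_j` is almost surely defined), the choice probabilities are positive (so that
`m` is finite), and they are measurable in the covariates. -/
structure IsProper [MeasurableSpace 𝒳] (M : ChoiceModel K p 𝒳)
    (Θ : Set (EuclideanSpace ℝ (Fin p))) : Prop where
  errorDensity : IsErrorDensity M.errorDensity
  scale_posSemidef : ∀ x, ∀ θ ∈ Θ, (M.scale x θ).PosSemidef
  no_ties : ∀ x, ∀ θ ∈ Θ, ∀ j k, j ≠ k → ∀ᵐ e ∂errorLaw M.errorDensity,
    latentUtility (M.utility x θ) (M.scale x θ) e j ≠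
      latentUtility (M.utility x θ) (M.scale x θ) e k
  prob_pos : ∀ x, ∀ θ ∈ Θ, ∀ j, 0 < M.prob x θ j
  prob_measurable : ∀ θ ∈ Θ, ∀ j, Measurable fun x => M.prob x θ j

/-- The law of one observation `(X, y)` when `X` has law `Q` and, given `X = x`, the choice `y`
equals `j` with probability `P_j(v*(x, θ), Σ*(x, θ))`. -/
def observationLaw [MeasurableSpace 𝒳] (M : ChoiceModel K p 𝒳) (Q : Measure 𝒳)
    (θ : EuclideanSpace ℝ (Fin p)) : Measure (𝒳 × Fin K) :=
  ∑ j, (Q.withDensity fun x => ENNReal.ofReal (M.prob x θ j)).map fun x => (x, j)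

/-- `E{m(y, X; θ)}` under the law `D` of `(X, y)`, as an extended real number in `[-∞, 0]`
(`m ≤ 0`, being the logarithm of a probability). -/
def expectedLogLik [MeasurableSpace 𝒳] (M : ChoiceModel K p 𝒳) (D : Measure (𝒳 × Fin K))
    (θ : EuclideanSpace ℝ (Fin p)) : EReal :=
  -((∫⁻ z, ENNReal.ofReal (-M.logLik z θ) ∂D : ℝ≥0∞) : EReal)

/-- The matrix `J(θ) = E{ψ(y, X; θ) ψ(y, X; θ)ᵀ}` under the law `D` of `(X, y)`. -/
def fisherInfo [MeasurableSpace 𝒳] (M : ChoiceModel K p 𝒳) (D : Measure (𝒳 × Fin K))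
    (θ : EuclideanSpace ℝ (Fin p)) : Matrix (Fin p) (Fin p) ℝ :=
  Matrix.of fun a b => ∫ z, M.score z θ a * M.score z θ b ∂D

/-- The regularity conditions on the model, where `D` is the law of `(X, y)` and `θ₀` the true
parameter. Smoothness on the compact set `Θ` is continuity on `Θ` together with two continuous
derivatives in its interior, and the suprema of the derivatives run over the interior. -/
structure IsRegular [MeasurableSpace 𝒳] (M : ChoiceModel K p 𝒳)
    (Θ : Set (EuclideanSpace ℝ (Fin p))) (D : Measure (𝒳 × Fin K))
    (θ₀ : EuclideanSpace ℝ (Fin p)) : Prop where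
  isCompact : IsCompact Θ
  mem_interior : θ₀ ∈ interior Θ
  unique_max : ∀ θ ∈ Θ, θ ≠ θ₀ → M.expectedLogLik D θ < M.expectedLogLik D θ₀
  integrable : Integrable (fun z => M.logLik z θ₀) D
  continuousOn : ∀ z, ContinuousOn (M.logLik z) Θ
  contDiffOn : ∀ z, ContDiffOn ℝ 2 (M.logLik z) (interior Θ)
  score_bound : ∫⁻ z, ⨆ θ ∈ interior Θ, ‖M.score z θ‖ₑ ^ 2 ∂D < ∞
  hessian_bound : ∫⁻ z, ⨆ θ ∈ interior Θ, ‖M.hessian z θ‖ₑ ∂D < ∞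
  fisherInfo_posDef : (M.fisherInfo D θ₀).PosDef

/-- The averaged log-likelihood `ℓ_n(θ)` of the observations `z 0, …, z (n - 1)`. -/
def avgLogLik (M : ChoiceModel K p 𝒳) (n : ℕ) (z : ℕ → 𝒳 × Fin K)
    (θ : EuclideanSpace ℝ (Fin p)) : ℝ :=
  (∑ i ∈ Finset.range n, M.logLik (z i) θ) / n

/-- The averaged log-likelihood at `θ` of the observations `z 0, …, z (n - 1)`, computed from an
emulator: a function `P` that sends `(v, Σ)` to approximate choice probabilities. -/
def emulatorAvgLogLik (M : ChoiceModel K p 𝒳)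
    (P : (Fin K → ℝ) → Matrix (Fin K) (Fin K) ℝ → Fin K → ℝ) (n : ℕ) (z : ℕ → 𝒳 × Fin K)
    (θ : EuclideanSpace ℝ (Fin p)) : ℝ :=
  (∑ i ∈ Finset.range n,
    Real.log (P (M.utility (z i).1 θ) (M.scale (z i).1 θ) (z i).2)) / n

end ChoiceModel

/-- `Z n = o_p(r n)` for nonnegative `Z n`. For `Z n` that need not be measurable the measure is
the outer measure. -/
def IsLittleOInProb {Ω : Type*} [MeasurableSpace Ω] (μ : Measure Ω) (Z : ℕ → Ω → ℝ≥0∞)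
    (r : ℕ → ℝ) : Prop :=
  ∀ δ : ℝ, 0 < δ → Tendsto (fun n => μ {ω | ENNReal.ofReal (δ * r n) < Z n ω}) atTop (𝓝 0)

end

/-!
Write `highProb` for the filter of events whose probability tends to one; along it, `o_p`
statements become ordinary limits. Wald's argument gives consistency: away from `θ₀` the sample
criterion is bounded above, uniformly on small neighbourhoods, by its value at `θ₀` minus a
constant. Near `θ₀` the sample criterion is, up to a constant, the concave quadratic
`⟪X̄, h⟫ - ⟪h, H h⟫ / 2` in `h = θ - θ₀`, where `X̄` is the mean gradient at `θ₀` and `-H` the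
expected Hessian; the remainder is `o_p(|h|²)` because the oscillation of the Hessian near `θ₀` is
small in mean. A point that maximizes the criterion up to `o_p(n⁻¹)`, as a maximizer of the
emulated criterion does, must lie within `o_p(n^{-1/2})` of the maximizer `H⁻¹ X̄` of the quadratic,
to which the central limit theorem applies. This gives the sandwich covariance `H⁻¹ V H⁻¹`, `V`
being the covariance of the gradient. For a likelihood, differentiating `∑ P_j = 1` twice shows
`H = V = J`, so that the sandwich collapses to `J⁻¹`.
-/

section Measurability

variable {𝒵 T β : Type*} [MeasurableSpace 𝒵] [TopologicalSpace T] [SecondCountableTopology T]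
  [CompleteLinearOrder β] [TopologicalSpace β] [OrderTopology β] [SecondCountableTopology β]
  [MeasurableSpace β] [BorelSpace β] {S : Set T} {f : 𝒵 → T → β}

lemma measurable_biSup_of_continuousOn (hf : ∀ z, ContinuousOn (f z) S)
    (hm : ∀ t ∈ S, Measurable fun z => f z t) : Measurable fun z => ⨆ t ∈ S, f z t := by
  obtain ⟨C, hC, hdense⟩ := TopologicalSpace.exists_countable_dense S
  have : Countable C := hC.to_subtype
  have hsup (z : 𝒵) : ⨆ t ∈ S, f z t = ⨆ t : C, f z t := by
    rw [iSup_subtype']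
    exact (hdense.ciSup' (continuousOn_iff_continuous_domRestrict.mp (hf z))).symm
  simp_rw [hsup]
  exact Measurable.iSup fun t => hm _ t.1.2

lemma measurable_biInf_of_continuousOn (hf : ∀ z, ContinuousOn (f z) S)
    (hm : ∀ t ∈ S, Measurable fun z => f z t) : Measurable fun z => ⨅ t ∈ S, f z t :=
  measurable_biSup_of_continuousOn (β := βᵒᵈ) hf hm

end Measurability

section MeasurabilityDerivative

variable {𝒵 E F : Type*} [MeasurableSpace 𝒵] [NormedAddCommGroup E] [NormedSpace ℝ E]
  [NormedAddCommGroup F] [NormedSpace ℝ F] [MeasurableSpace F] [BorelSpace F]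
  [SecondCountableTopology F] {G : 𝒵 → E → F} {U : Set E} {θ : E}

lemma measurable_fderiv_param_apply (hU : U ∈ 𝓝 θ) (hG : ∀ θ' ∈ U, Measurable fun z => G z θ')
    (hd : ∀ z, DifferentiableAt ℝ (G z) θ) (v : E) :
    Measurable fun z => fderiv ℝ (G z) θ v := by
  have htend : Tendsto (fun n : ℕ => θ + (n : ℝ)⁻¹ • v) atTop (𝓝 θ) := by
    simpa using ((tendsto_inv_atTop_nhds_zero_nat (𝕜 := ℝ)).smul_const v).const_add θ
  obtain ⟨N, hN⟩ := eventually_atTop.mp (htend.eventually hU)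
  refine measurable_of_tendsto_metrizable (f := fun n z =>
    ((n + N : ℕ) : ℝ) • (G z (θ + ((n + N : ℕ) : ℝ)⁻¹ • v) - G z θ)) (fun n => ?_) ?_
  · exact ((hG _ (hN _ (Nat.le_add_left _ _))).sub (hG θ (mem_of_mem_nhds hU))).const_smul _
  · refine tendsto_pi_nhds.mpr fun z => ?_
    have := (hd z).hasFDerivAt.lim v (c := fun n : ℕ => (n : ℝ)) (l := atTop)
      (by simpa using tendsto_natCast_atTop_atTop)
    exact (tendsto_add_atTop_iff_nat N).mpr this

variable [FiniteDimensional ℝ E]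

lemma measurable_fderiv_param (hU : U ∈ 𝓝 θ) (hG : ∀ θ' ∈ U, Measurable fun z => G z θ')
    (hd : ∀ z, DifferentiableAt ℝ (G z) θ) : Measurable fun z => fderiv ℝ (G z) θ := by
  let b := Module.finBasis ℝ E
  have hsum (z : 𝒵) : fderiv ℝ (G z) θ = ∑ i, ContinuousLinearMap.smulRightL ℝ E F
      (LinearMap.toContinuousLinearMap (b.coord i)) (fderiv ℝ (G z) θ (b i)) := by
    ext v
    conv_lhs => rw [← b.sum_repr v, map_sum]
    simp
  rw [funext hsum]
  exact Finset.measurable_fun_sum _ fun i _ =>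
    (ContinuousLinearMap.continuous _).measurable.comp (measurable_fderiv_param_apply hU hG hd _)

end MeasurabilityDerivative

lemma measurable_gradient_param {𝒵 E : Type*} [MeasurableSpace 𝒵] [NormedAddCommGroup E]
    [InnerProductSpace ℝ E] [FiniteDimensional ℝ E] [MeasurableSpace E] [BorelSpace E]
    {m : 𝒵 → E → ℝ} {U : Set E} {θ : E} (hU : U ∈ 𝓝 θ)
    (hm : ∀ θ' ∈ U, Measurable fun z => m z θ') (hd : ∀ z, DifferentiableAt ℝ (m z) θ) :
    Measurable fun z => ∇ (m z) θ :=
  (InnerProductSpace.toDual ℝ E).symm.continuous.measurable.comp (measurable_fderiv_param hU hm hd)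

section HighProb

variable {ι Ω : Type*} [MeasurableSpace Ω] {l : Filter ι} {μ : Measure Ω}

/-- The filter of the events whose probability tends to one along `l`, an event that depends on
`i : ι` being encoded as a subset of `ι × Ω`. Along it, convergence in probability is convergence,
and `∀ᶠ` means "with probability tending to one". Events need not be measurable: `μ` is used as an
outer measure. -/
def highProb (l : Filter ι) (μ : Measure Ω) : Filter (ι × Ω) where
  sets := {S | Tendsto (fun i => μ {ω | (i, ω) ∉ S}) l (𝓝 0)}
  univ_sets := by simp [tendsto_const_nhds]
  sets_of_superset {S S'} hS hSS' := tendsto_of_tendsto_of_tendsto_of_le_of_le tendsto_const_nhds hS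
    (fun _ => zero_le) fun i => measure_mono fun ω hω hωS => hω (hSS' hωS)
  inter_sets {S S'} hS hS' := by
    refine tendsto_of_tendsto_of_tendsto_of_le_of_le tendsto_const_nhds
      (by simpa using Tendsto.add hS hS') (fun _ => zero_le) fun i => ?_
    refine (measure_mono fun ω hω => ?_).trans (measure_union_le _ _)
    exact not_and_or.mp hω

lemma eventually_highProb {P : ι × Ω → Prop} :
    (∀ᶠ q in highProb l μ, P q) ↔ Tendsto (fun i => μ {ω | ¬P (i, ω)}) l (𝓝 0) :=
  Iff.rfl

lemma eventually_highProb_of_ae {P : ι × Ω → Prop} (h : ∀ᶠ i in l, ∀ᵐ ω ∂μ, P (i, ω)) :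
    ∀ᶠ q in highProb l μ, P q :=
  eventually_highProb.mpr (tendsto_const_nhds.congr' (h.mono fun _ hi => (ae_iff.mp hi).symm))

lemma tendsto_fst_highProb : Tendsto Prod.fst (highProb l μ) l := fun _ hs =>
  eventually_highProb_of_ae (mem_of_superset hs fun _ hi => ae_of_all _ fun _ => hi)

lemma tendsto_snd_highProb : Tendsto Prod.snd (highProb l μ) (ae μ) := fun _ hs =>
  eventually_highProb_of_ae (Eventually.of_forall fun _ => hs)

lemma tendstoInMeasure_const_iff {E : Type*} [PseudoEMetricSpace E] {f : ι → Ω → E} {c : E} :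
    TendstoInMeasure μ f l (fun _ => c) ↔
      Tendsto (fun q => f q.1 q.2) (highProb l μ) (𝓝 c) := by
  simp [TendstoInMeasure, EMetric.tendsto_nhds, eventually_highProb]

lemma isLittleOInProb_iff {Z : ℕ → Ω → ℝ≥0∞} {r : ℕ → ℝ} :
    IsLittleOInProb μ Z r ↔
      ∀ δ : ℝ, 0 < δ → ∀ᶠ q in highProb atTop μ, Z q.1 q.2 ≤ ENNReal.ofReal (δ * r q.1) := by
  simp [IsLittleOInProb, eventually_highProb]

variable {E : Type*} [NormedAddCommGroup E]

lemma tendsto_highProb_zero_of_norm_sq_le {X R : ι → Ω → E}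
    (hX : ∀ ε > 0, ∃ C : ℝ, ∀ᶠ i in l, μ {ω | C ≤ ‖X i ω‖} ≤ ε)
    (hR : ∀ κ > 0, ∀ᶠ q in highProb l μ, ‖R q.1 q.2‖ ^ 2 ≤ κ * (‖X q.1 q.2‖ ^ 2 + 1)) :
    Tendsto (fun q => R q.1 q.2) (highProb l μ) (𝓝 0) := by
  simp_rw [Metric.tendsto_nhds, dist_zero_right]
  intro η hη
  rw [eventually_highProb, ENNReal.tendsto_nhds_zero]
  intro ε hε
  obtain ⟨C, hC⟩ := hX (ε / 2) (ENNReal.half_pos hε.ne')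
  set κ := η ^ 2 / (2 * (C ^ 2 + 1)) with hκ
  have hRκ := eventually_highProb.mp (hR κ (by positivity))
  filter_upwards [hC, ENNReal.tendsto_nhds_zero.mp hRκ (ε / 2) (ENNReal.half_pos hε.ne')]
    with i hi₁ hi₂
  rw [← ENNReal.add_halves ε]
  refine le_trans (measure_mono fun ω hω => ?_) ((measure_union_le _ _).trans (add_le_add hi₁ hi₂))
  by_contra hcon
  obtain ⟨hXC, hRX⟩ : ‖X i ω‖ < C ∧ ‖R i ω‖ ^ 2 ≤ κ * (‖X i ω‖ ^ 2 + 1) := by simpa using hcon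
  refine hω (lt_of_pow_lt_pow_left₀ 2 hη.le (hRX.trans_lt ?_))
  calc κ * (‖X i ω‖ ^ 2 + 1) ≤ κ * (C ^ 2 + 1) := by gcongr
    _ = η ^ 2 / 2 := by rw [hκ]; field_simp
    _ < η ^ 2 := half_lt_self (by positivity)

lemma exists_measure_norm_ge_le_of_tendstoInDistribution [NormedSpace ℝ E] [FiniteDimensional ℝ E]
    [MeasurableSpace E] [BorelSpace E] {Ω' : Type*} [MeasurableSpace Ω'] {ν : Measure Ω'}
    [IsProbabilityMeasure ν] [IsProbabilityMeasure μ] {X : ι → Ω → E} {Y : Ω' → E}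
    (h : TendstoInDistribution X l Y (fun _ => μ) ν) {ε : ℝ≥0∞} (hε : 0 < ε) :
    ∃ C : ℝ, ∀ᶠ i in l, μ {ω | C ≤ ‖X i ω‖} ≤ ε := by
  have : IsProbabilityMeasure (ν.map Y) := Measure.isProbabilityMeasure_map h.aemeasurable_limit
  have hlim := tendsto_measure_norm_gt_of_isTightMeasureSet
    (isTightMeasureSet_singleton (μ := ν.map Y))
  simp only [Set.mem_singleton_iff, iSup_iSup_eq_left] at hlim
  obtain ⟨C, hC⟩ := (hlim.eventually (gt_mem_nhds hε)).exists
  have hclosed : IsClosed {y : E | C + 1 ≤ ‖y‖} := isClosed_le continuous_const continuous_norm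
  have hsub : ν.map Y {y | C + 1 ≤ ‖y‖} < ε :=
    (measure_mono fun y (hy : C + 1 ≤ ‖y‖) => (lt_add_one C).trans_le hy).trans_lt hC
  refine ⟨C + 1, ?_⟩
  filter_upwards [eventually_lt_of_limsup_lt
    ((ProbabilityMeasure.limsup_measure_closed_le_of_tendsto h.tendsto hclosed).trans_lt hsub)]
    with i hi
  simp only [ProbabilityMeasure.coe_mk] at hi
  rw [Measure.map_apply_of_aemeasurable (h.forall_aemeasurable i) hclosed.measurableSet] at hi
  exact hi.le

end HighProb

section SampleMean

variable {Ω 𝒵 F G : Type*} [NormedAddCommGroup F] [NormedSpace ℝ F] [NormedAddCommGroup G]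
  [NormedSpace ℝ G] {Z : ℕ → Ω → 𝒵} {q : ℕ × Ω}

/-- The average of `g` over the first `n` of the observations `Z 0, Z 1, …`, on the outcome `ω`,
where `q = (n, ω)` as in `highProb`. -/
noncomputable def sampleMean (Z : ℕ → Ω → 𝒵) (g : 𝒵 → F) (q : ℕ × Ω) : F :=
  (q.1 : ℝ)⁻¹ • ∑ i ∈ Finset.range q.1, g (Z i q.2)

lemma sampleMean_sub (f g : 𝒵 → F) :
    sampleMean Z (fun z => f z - g z) q = sampleMean Z f q - sampleMean Z g q := by
  simp only [sampleMean, Finset.sum_sub_distrib, smul_sub]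

lemma map_sampleMean (L : F →L[ℝ] G) (g : 𝒵 → F) :
    sampleMean Z (fun z => L (g z)) q = L (sampleMean Z g q) := by
  simp only [sampleMean, map_smul, map_sum]

lemma sampleMean_mono {f g : 𝒵 → ℝ} (h : ∀ i, f (Z i q.2) ≤ g (Z i q.2)) :
    sampleMean Z f q ≤ sampleMean Z g q :=
  smul_le_smul_of_nonneg_left (Finset.sum_le_sum fun i _ => h i) (by positivity)

lemma abs_sampleMean_le {f g : 𝒵 → ℝ} (h : ∀ i, |f (Z i q.2)| ≤ g (Z i q.2)) :
    |sampleMean Z f q| ≤ sampleMean Z g q := by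
  simp only [sampleMean, smul_eq_mul, abs_mul, abs_inv, Nat.abs_cast]
  gcongr
  exact (Finset.abs_sum_le_sum_abs _ _).trans (Finset.sum_le_sum fun i _ => h i)

end SampleMean

section SecondMoment

variable {ι 𝒵 : Type*} [MeasurableSpace 𝒵] {D : Measure 𝒵} {g : 𝒵 → EuclideanSpace ℝ ι}

/-- The uncentred second-moment matrix `E{g gᵀ}` of a random vector `g`; for `g = ∇m` at the
maximizer, where `g` has mean zero, it is the asymptotic covariance of `n^{-1/2} ∑ g`. -/
noncomputable def secondMoment (g : 𝒵 → EuclideanSpace ℝ ι) (D : Measure 𝒵) : Matrix ι ι ℝ :=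
  Matrix.of fun a b => ∫ z, g z a * g z b ∂D

variable [Fintype ι]

lemma integral_inner_sq_eq_secondMoment (hg : MemLp g 2 D) (t : EuclideanSpace ℝ ι) :
    ∫ z, inner ℝ (g z) t ^ 2 ∂D = t.ofLp ⬝ᵥ (secondMoment g D).mulVec t.ofLp := by
  have hint (a b : ι) : Integrable (fun z => g z a * g z b) D :=
    (hg.eval_piLp a).integrable_mul (hg.eval_piLp b)
  have hsq (z : 𝒵) : inner ℝ (g z) t ^ 2 = ∑ a, ∑ b, t a * t b * (g z a * g z b) := by
    simp only [PiLp.inner_apply, pow_two, Finset.sum_mul_sum, RCLike.inner_apply, conj_trivial]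
    exact Finset.sum_congr rfl fun a _ => Finset.sum_congr rfl fun b _ => by ring
  simp_rw [hsq, dotProduct, Matrix.mulVec, dotProduct, Finset.mul_sum]
  rw [integral_finsetSum _ fun a _ => integrable_finsetSum _ fun b _ => (hint a b).const_mul _]
  refine Finset.sum_congr rfl fun a _ => ?_
  rw [integral_finsetSum _ fun b _ => (hint a b).const_mul _]
  refine Finset.sum_congr rfl fun b _ => ?_
  rw [integral_const_mul, secondMoment, Matrix.of_apply]
  ring

lemma posSemidef_secondMoment (hg : MemLp g 2 D) : (secondMoment g D).PosSemidef := by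
  refine .of_dotProduct_mulVec_nonneg ?_ fun t => ?_
  · ext a b
    simp [secondMoment, mul_comm]
  · simpa [← integral_inner_sq_eq_secondMoment hg (WithLp.toLp 2 t)] using
      integral_nonneg fun z => sq_nonneg (inner ℝ (g z) (WithLp.toLp 2 t))

lemma secondMoment_toEuclideanCLM [DecidableEq ι] (hg : MemLp g 2 D) (S : Matrix ι ι ℝ) :
    secondMoment (fun z => Matrix.toEuclideanCLM (𝕜 := ℝ) S (g z)) D =
      S * secondMoment g D * S.transpose := by
  have hint (a b c d : ι) : Integrable (fun z => S a c * S b d * (g z c * g z d)) D :=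
    ((hg.eval_piLp c).integrable_mul (hg.eval_piLp d)).const_mul _
  ext a b
  calc secondMoment (fun z => Matrix.toEuclideanCLM (𝕜 := ℝ) S (g z)) D a b
      = ∫ z, ∑ d, ∑ c, S a c * S b d * (g z c * g z d) ∂D := by
        refine integral_congr_ae (ae_of_all _ fun z => ?_)
        simp only [Matrix.ofLp_toEuclideanCLM, Matrix.mulVec, dotProduct, Finset.sum_mul_sum]
        rw [Finset.sum_comm]
        exact Finset.sum_congr rfl fun d _ => Finset.sum_congr rfl fun c _ => by ring
    _ = ∑ d, ∑ c, S a c * S b d * ∫ z, g z c * g z d ∂D := by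
        rw [integral_finsetSum _ fun d _ => integrable_finsetSum _ fun c _ => hint a b c d]
        refine Finset.sum_congr rfl fun d _ => ?_
        rw [integral_finsetSum _ fun c _ => hint a b c d]
        exact Finset.sum_congr rfl fun c _ => integral_const_mul _ _
    _ = (S * secondMoment g D * S.transpose) a b := by
        simp only [Matrix.mul_apply, Finset.sum_mul, secondMoment, Matrix.of_apply,
          Matrix.transpose_apply]
        exact Finset.sum_congr rfl fun d _ => Finset.sum_congr rfl fun c _ => by ring

end SecondMoment

section LimitTheorems

variable {Ω 𝒵 : Type*} [MeasurableSpace Ω] [MeasurableSpace 𝒵] {μ : Measure Ω} {D : Measure 𝒵}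
  {Z : ℕ → Ω → 𝒵}

lemma identDistrib_comp_of_hasLaw {F : Type*} [MeasurableSpace F]
    (hlaw : ∀ i, HasLaw (Z i) D μ) {g : 𝒵 → F} (hg : Measurable g) (i j : ℕ) :
    IdentDistrib (fun ω => g (Z i ω)) (fun ω => g (Z j ω)) μ μ :=
  IdentDistrib.comp ⟨(hlaw i).aemeasurable, (hlaw j).aemeasurable,
    by rw [(hlaw i).map_eq, (hlaw j).map_eq]⟩ hg

lemma aemeasurable_sum_comp_of_hasLaw {F : Type*} [AddCommMonoid F] [MeasurableSpace F]
    [MeasurableAdd₂ F] (hlaw : ∀ i, HasLaw (Z i) D μ) {g : 𝒵 → F} (hg : Measurable g)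
    (s : Finset ℕ) : AEMeasurable (fun ω => ∑ i ∈ s, g (Z i ω)) μ :=
  Finset.aemeasurable_fun_sum _ fun i _ => hg.comp_aemeasurable (hlaw i).aemeasurable

lemma charFun_map_inner {E : Type*} [NormedAddCommGroup E] [InnerProductSpace ℝ E]
    [MeasurableSpace E] [BorelSpace E] [SecondCountableTopology E] {X : Ω → E}
    (hX : AEMeasurable X μ) (t : E) (u : ℝ) :
    charFun (μ.map fun ω => inner ℝ (X ω) t) u = charFun (μ.map X) (u • t) := by
  rw [charFun_apply, charFun_apply, integral_map hX.inner_const (by fun_prop),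
    integral_map hX (by fun_prop)]
  simp [inner_smul_right]

variable [IsProbabilityMeasure μ]

lemma tendsto_sampleMean {F : Type*} [NormedAddCommGroup F] [NormedSpace ℝ F]
    [CompleteSpace F] [SecondCountableTopology F] [MeasurableSpace F] [BorelSpace F]
    (hindep : iIndepFun Z μ) (hlaw : ∀ i, HasLaw (Z i) D μ) {g : 𝒵 → F} (hg : Measurable g)
    (hint : Integrable g D) :
    Tendsto (sampleMean Z g) (highProb atTop μ) (𝓝 (∫ z, g z ∂D)) := by
  have hmean : ∫ ω, g (Z 0 ω) ∂μ = ∫ z, g z ∂D := (hlaw 0).integral_comp hint.aestronglyMeasurable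
  have hint₀ : Integrable (fun ω => g (Z 0 ω)) μ :=
    ((hlaw 0).map_eq.symm ▸ hint).comp_aemeasurable (hlaw 0).aemeasurable
  have hmeas (n : ℕ) : AEStronglyMeasurable (fun ω => sampleMean Z g (n, ω)) μ :=
    (AEMeasurable.const_smul (aemeasurable_sum_comp_of_hasLaw hlaw hg (Finset.range n))
      (n : ℝ)⁻¹).aestronglyMeasurable
  rw [← hmean]
  refine tendstoInMeasure_const_iff (f := fun n ω => sampleMean Z g (n, ω)).mp
    (tendstoInMeasure_of_tendsto_ae hmeas ?_)
  exact strong_law_ae (fun i ω => g (Z i ω)) hint₀ (fun i j hij => (hindep.indepFun hij).comp hg hg)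
    fun i => identDistrib_comp_of_hasLaw hlaw hg i 0

variable {Ω' : Type*} [MeasurableSpace Ω'] {ν : Measure Ω'} [IsProbabilityMeasure ν]

lemma tendstoInDistribution_sum_gaussianReal (hindep : iIndepFun Z μ)
    (hlaw : ∀ i, HasLaw (Z i) D μ) {g : 𝒵 → ℝ} (hg : Measurable g) (hL2 : MemLp g 2 D)
    (hmean : ∫ z, g z ∂D = 0) {Y : Ω' → ℝ}
    (hY : HasLaw Y (gaussianReal 0 (∫ z, g z ^ 2 ∂D).toNNReal) ν) :
    TendstoInDistribution (fun (n : ℕ) ω => (√(n : ℝ))⁻¹ * ∑ i ∈ Finset.range n, g (Z i ω)) atTop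
      Y (fun _ => μ) ν := by
  rw [← (hlaw 0).map_eq] at hL2
  have hmean₀ : ∫ ω, g (Z 0 ω) ∂μ = 0 :=
    ((hlaw 0).integral_comp hg.aestronglyMeasurable).trans hmean
  have hvar : Var[fun ω => g (Z 0 ω); μ] = ∫ z, g z ^ 2 ∂D := by
    rw [variance_of_integral_eq_zero (X := fun ω => g (Z 0 ω))
      (hg.comp_aemeasurable (hlaw 0).aemeasurable) hmean₀]
    exact (hlaw 0).integral_comp (hg.pow_const 2).aestronglyMeasurable
  simpa only [hmean₀, mul_zero, sub_zero] using tendstoInDistribution_inv_sqrt_mul_sum_sub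
    (X := fun i ω => g (Z i ω)) (hvar ▸ hY) (hL2.comp_of_map (hlaw 0).aemeasurable)
    (hindep.comp (fun _ => g) fun _ => hg) (fun i => identDistrib_comp_of_hasLaw hlaw hg i 0)

lemma tendstoInDistribution_of_inner {E : Type*} [NormedAddCommGroup E] [InnerProductSpace ℝ E]
    [FiniteDimensional ℝ E] [MeasurableSpace E] [BorelSpace E] {X : ℕ → Ω → E} {Y : Ω' → E}
    (hX : ∀ n, AEMeasurable (X n) μ) (hY : AEMeasurable Y ν)
    (h : ∀ t, TendstoInDistribution (fun n ω => inner ℝ (X n ω) t) atTop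
      (fun ω => inner ℝ (Y ω) t) (fun _ => μ) ν) :
    TendstoInDistribution X atTop Y (fun _ => μ) ν := by
  refine ⟨hX, hY, ProbabilityMeasure.tendsto_iff_tendsto_charFun.2 fun t => ?_⟩
  simpa only [ProbabilityMeasure.coe_mk, charFun_map_inner hY, charFun_map_inner (hX _), one_smul]
    using ProbabilityMeasure.tendsto_iff_tendsto_charFun.1 (h t).tendsto 1

variable {ι : Type*} [Fintype ι] [DecidableEq ι] {S : Matrix ι ι ℝ}

lemma hasLaw_inner_multivariateGaussian (hS : S.PosSemidef) (t : EuclideanSpace ℝ ι) :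
    HasLaw (fun y => inner ℝ y t) (gaussianReal 0 (t.ofLp ⬝ᵥ S.mulVec t.ofLp).toNNReal)
      (multivariateGaussian 0 S) := by
  refine ⟨by fun_prop, Measure.ext_of_charFun (funext fun u => ?_)⟩
  have hpos : 0 ≤ t.ofLp ⬝ᵥ S.mulVec t.ofLp := by simpa using hS.dotProduct_mulVec_nonneg t.ofLp
  rw [charFun_map_inner (X := fun y => y) aemeasurable_id, Measure.map_id',
    charFun_multivariateGaussian hS, charFun_gaussianReal]
  simp only [inner_zero_right, WithLp.ofLp_smul, Matrix.mulVec_smul, smul_dotProduct,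
    dotProduct_smul, smul_eq_mul, Real.coe_toNNReal _ hpos]
  push_cast
  ring_nf

lemma tendstoInDistribution_sum_multivariateGaussian (hindep : iIndepFun Z μ)
    (hlaw : ∀ i, HasLaw (Z i) D μ) {g : 𝒵 → EuclideanSpace ℝ ι} (hg : Measurable g)
    (hL2 : MemLp g 2 D) (hmean : ∫ z, g z ∂D = 0) :
    TendstoInDistribution (fun (n : ℕ) ω => (√(n : ℝ))⁻¹ • ∑ i ∈ Finset.range n, g (Z i ω)) atTop
      id (fun _ => μ) (multivariateGaussian 0 (secondMoment g D)) := by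
  have : IsFiniteMeasure D := (hlaw 0).isFiniteMeasure_iff.mp inferInstance
  have hint : Integrable g D := hL2.integrable one_le_two
  refine tendstoInDistribution_of_inner
    (fun n => AEMeasurable.const_smul (aemeasurable_sum_comp_of_hasLaw hlaw hg _) (√(n : ℝ))⁻¹)
    aemeasurable_id fun t => ?_
  have hmean' : ∫ z, inner ℝ (g z) t ∂D = 0 := by
    simp_rw [real_inner_comm t, integral_inner hint, hmean, inner_zero_right]
  simp only [inner_smul_left, sum_inner, id, RCLike.conj_to_real]
  exact tendstoInDistribution_sum_gaussianReal hindep hlaw hg.inner_const (hL2.inner_const t)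
    hmean' (integral_inner_sq_eq_secondMoment hL2 t ▸
      hasLaw_inner_multivariateGaussian (posSemidef_secondMoment hL2) t)

end LimitTheorems

section Consistency

variable {Ω 𝒵 T : Type*} [MeasurableSpace Ω] [MeasurableSpace 𝒵] [TopologicalSpace T]
  {μ : Measure Ω} {D : Measure 𝒵} {Θ : Set T} {θ θ₀ : T}

lemma exists_biInf_lintegral_gt [SecondCountableTopology T] {f : 𝒵 → T → ℝ≥0∞}
    (hf : ∀ z, ContinuousOn (f z) Θ) (hm : ∀ θ ∈ Θ, Measurable fun z => f z θ) (hθ : θ ∈ Θ)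
    {a : ℝ≥0∞} (ha : a < ∫⁻ z, f z θ ∂D) :
    ∃ V ∈ 𝓝[Θ] θ, a < ∫⁻ z, ⨅ t ∈ V, f z t ∂D := by
  obtain ⟨B, hB⟩ := (𝓝 θ).exists_antitone_basis
  have hbasis := nhdsWithin_hasBasis hB.toHasBasis Θ
  have hsup (z : 𝒵) : ⨆ k, ⨅ t ∈ B k ∩ Θ, f z t = f z θ := by
    have : (𝓝[Θ] θ).NeBot := mem_closure_iff_nhdsWithin_neBot.mp (subset_closure hθ)
    simpa using hbasis.liminf_eq_iSup_iInf.symm.trans (hf z θ hθ).tendsto.liminf_eq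
  have hmeas (k : ℕ) : Measurable fun z => ⨅ t ∈ B k ∩ Θ, f z t :=
    measurable_biInf_of_continuousOn (fun z => (hf z).mono Set.inter_subset_right)
      fun t ht => hm t ht.2
  have hmono : Monotone fun k z => ⨅ t ∈ B k ∩ Θ, f z t := fun i j hij z =>
    biInf_mono fun t ht => ⟨hB.antitone hij ht.1, ht.2⟩
  simp_rw [← hsup, lintegral_iSup hmeas hmono] at ha
  obtain ⟨k, hk⟩ := lt_iSup_iff.mp ha
  exact ⟨B k ∩ Θ, hbasis.mem_of_mem trivial, hk⟩

lemma exists_simpleFunc_le_lintegral_gt {f : 𝒵 → ℝ≥0∞} {a : ℝ≥0∞} (ha : a < ∫⁻ z, f z ∂D) :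
    ∃ φ : SimpleFunc 𝒵 NNReal, (∀ z, (φ z : ℝ≥0∞) ≤ f z) ∧ a < ∫⁻ z, φ z ∂D := by
  rw [lintegral_eq_nnreal] at ha
  obtain ⟨φ, hφ, hlt⟩ : ∃ φ : SimpleFunc 𝒵 NNReal, ∃ _ : ∀ z, (φ z : ℝ≥0∞) ≤ f z,
      a < (φ.map ((↑) : NNReal → ℝ≥0∞)).lintegral D := by simpa only [lt_iSup_iff] using ha
  rw [← SimpleFunc.lintegral_eq_lintegral] at hlt
  exact ⟨φ, hφ, hlt⟩

lemma tendsto_of_forall_ne_exists_eventually_notMem {Q : Type*} {F : Filter Q} {u : Q → T}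
    (hΘ : IsCompact Θ) (hu : ∀ᶠ q in F, u q ∈ Θ)
    (h : ∀ θ ∈ Θ, θ ≠ θ₀ → ∃ V ∈ 𝓝[Θ] θ, ∀ᶠ q in F, u q ∉ V) : Tendsto u F (𝓝 θ₀) := by
  refine hΘ.le_nhds_of_unique_clusterPt hu fun θ hθ hcluster => ?_
  by_contra hne
  obtain ⟨V, hV, huV⟩ := h θ hθ hne
  obtain ⟨W, hW, hWV⟩ := mem_nhdsWithin_iff_exists_mem_nhds_inter.mp hV
  obtain ⟨t, htW, htΘ, htV⟩ := clusterPt_iff_nonempty.mp hcluster hW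
    (show {t | t ∈ Θ ∧ t ∉ V} ∈ map u F from hu.and huV)
  exact htV (hWV ⟨htW, htΘ⟩)

variable [SecondCountableTopology T] [IsProbabilityMeasure μ] [IsFiniteMeasure D]
  {Z : ℕ → Ω → 𝒵} {m : 𝒵 → T → ℝ}

/- Wald's argument: replacing `m` by its supremum over a small neighbourhood of `θ` changes the
expected criterion only a little, and bounds the sample criterion on the whole neighbourhood. -/
lemma exists_eventually_sampleMean_add_lt (hindep : iIndepFun Z μ) (hlaw : ∀ i, HasLaw (Z i) D μ)
    (hmeas : ∀ θ ∈ Θ, Measurable fun z => m z θ) (hcont : ∀ z, ContinuousOn (m z) Θ)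
    (hneg : ∀ z, ∀ θ ∈ Θ, m z θ ≤ 0) (hθ₀ : θ₀ ∈ Θ) (hint : Integrable (fun z => m z θ₀) D)
    (hθ : θ ∈ Θ)
    (hlt : ∫⁻ z, ENNReal.ofReal (-m z θ₀) ∂D < ∫⁻ z, ENNReal.ofReal (-m z θ) ∂D) :
    ∃ V ∈ 𝓝[Θ] θ, ∃ δ > 0, ∀ᶠ q in highProb atTop μ, ∀ t ∈ V,
      sampleMean Z (fun z => m z t) q + δ < sampleMean Z (fun z => m z θ₀) q := by
  obtain ⟨V, hV, hVlt⟩ := exists_biInf_lintegral_gt (D := D)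
    (fun z => ENNReal.continuous_ofReal.comp_continuousOn (hcont z).neg)
    (fun t ht => (hmeas t ht).neg.ennreal_ofReal) hθ hlt
  obtain ⟨φ, hφ, hφlt⟩ := exists_simpleFunc_le_lintegral_gt hVlt
  have hφint : Integrable (fun z => (φ z : ℝ)) D :=
    (φ.map ((↑) : NNReal → ℝ)).integrable_of_isFiniteMeasure
  have hφle (z : 𝒵) (t : T) (ht : t ∈ V ∩ Θ) : m z t ≤ -(φ z : ℝ) := by
    have : (φ z : ℝ≥0∞) ≤ ENNReal.ofReal (-m z t) := (hφ z).trans (iInf₂_le t ht.1)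
    rw [← ENNReal.ofReal_coe_nnreal, ENNReal.ofReal_le_ofReal_iff
      (neg_nonneg.mpr (hneg z t ht.2))] at this
    linarith
  have hgap : 0 < ∫ z, (m z θ₀ + φ z) ∂D := by
    rw [← ofReal_integral_eq_lintegral_ofReal (f := fun z => -m z θ₀) hint.neg
      (ae_of_all _ fun z => neg_nonneg.mpr (hneg z θ₀ hθ₀)), integral_neg] at hφlt
    simp_rw [← ENNReal.ofReal_coe_nnreal] at hφlt
    rw [← ofReal_integral_eq_lintegral_ofReal hφint (ae_of_all _ fun z => (φ z).coe_nonneg)] at hφlt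
    rw [integral_add hint hφint]
    linarith [(ENNReal.ofReal_lt_ofReal_iff_of_nonneg
      (neg_nonneg.mpr (integral_nonpos fun z => hneg z θ₀ hθ₀))).mp hφlt]
  refine ⟨V ∩ Θ, inter_mem hV self_mem_nhdsWithin, _, half_pos hgap, ?_⟩
  have hlln := tendsto_sampleMean (g := fun z => m z θ₀ + φ z) hindep hlaw
    ((hmeas θ₀ hθ₀).add φ.measurable.coe_nnreal_real) (hint.add hφint)
  filter_upwards [hlln.eventually (lt_mem_nhds (half_lt_self hgap))] with q hq t ht
  have hle : sampleMean Z (fun z => m z θ₀ + φ z) q ≤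
      sampleMean Z (fun z => m z θ₀ - m z t) q :=
    sampleMean_mono fun i => by linarith [hφle (Z i q.2) t ht]
  rw [sampleMean_sub] at hle
  linarith

theorem tendsto_approx_argmax_sampleMean (hindep : iIndepFun Z μ) (hlaw : ∀ i, HasLaw (Z i) D μ)
    (hΘ : IsCompact Θ) (hmeas : ∀ θ ∈ Θ, Measurable fun z => m z θ)
    (hcont : ∀ z, ContinuousOn (m z) Θ) (hneg : ∀ z, ∀ θ ∈ Θ, m z θ ≤ 0)
    (hθ₀ : θ₀ ∈ Θ) (hint : Integrable (fun z => m z θ₀) D)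
    (hmax : ∀ θ ∈ Θ, θ ≠ θ₀ →
      ∫⁻ z, ENNReal.ofReal (-m z θ₀) ∂D < ∫⁻ z, ENNReal.ofReal (-m z θ) ∂D)
    {u : ℕ × Ω → T} (hu : ∀ᶠ q in highProb atTop μ, u q ∈ Θ)
    (happrox : ∀ δ > 0, ∀ᶠ q in highProb atTop μ,
      sampleMean Z (fun z => m z θ₀) q ≤ sampleMean Z (fun z => m z (u q)) q + δ) :
    Tendsto u (highProb atTop μ) (𝓝 θ₀) := by
  refine tendsto_of_forall_ne_exists_eventually_notMem hΘ hu fun θ hθ hne => ?_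
  obtain ⟨V, hV, δ, hδ, hlt⟩ := exists_eventually_sampleMean_add_lt hindep hlaw hmeas hcont hneg
    hθ₀ hint hθ (hmax θ hθ hne)
  exact ⟨V, hV, by filter_upwards [hlt, happrox δ hδ] with q hq hq' huV
    using (hq _ huV).not_ge hq'⟩

end Consistency

section Taylor

lemma differentiableAt_of_contDiffOn_two {E : Type*} [NormedAddCommGroup E] [NormedSpace ℝ E]
    {f : E → ℝ} {U : Set E} {θ : E} (hU : IsOpen U) (hf : ContDiffOn ℝ 2 f U) (hθ : θ ∈ U) :
    DifferentiableAt ℝ f θ :=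
  (hf.differentiableOn (by norm_num)).differentiableAt (hU.mem_nhds hθ)

variable {E : Type*} [NormedAddCommGroup E] [InnerProductSpace ℝ E] [CompleteSpace E]
  {f : E → ℝ} {U : Set E} {θ θ₀ h : E}

lemma contDiffOn_gradient (hU : IsOpen U) (hf : ContDiffOn ℝ 2 f U) : ContDiffOn ℝ 1 (∇ f) U :=
  (InnerProductSpace.toDual ℝ E).symm.contDiff.comp_contDiffOn
    (hf.fderiv_of_isOpen hU (by norm_num))

lemma differentiableAt_gradient (hU : IsOpen U) (hf : ContDiffOn ℝ 2 f U) (hθ : θ ∈ U) :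
    DifferentiableAt ℝ (∇ f) θ :=
  ((contDiffOn_gradient hU hf).differentiableOn (by norm_num)).differentiableAt (hU.mem_nhds hθ)

lemma hasDerivAt_comp_line_sub_quadratic {g g₀ : E} {H : E →L[ℝ] E} {t : ℝ}
    (hf : HasGradientAt f g (θ₀ + t • h)) :
    HasDerivAt (fun t : ℝ => f (θ₀ + t • h) - t * inner ℝ g₀ h - t ^ 2 * (inner ℝ h (H h) / 2))
      (inner ℝ (g - g₀ - t • H h) h) t := by
  have hline : HasDerivAt (fun t : ℝ => θ₀ + t • h) h t := by
    simpa using ((hasDerivAt_id t).smul_const h).const_add θ₀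
  refine (((hf.hasFDerivAt.comp_hasDerivAt t hline).sub
    ((hasDerivAt_id t).mul_const (inner ℝ g₀ h))).sub
      ((hasDerivAt_pow 2 t).mul_const (inner ℝ h (H h) / 2))).congr_deriv ?_
  rw [inner_sub_left, inner_sub_left, inner_smul_left, real_inner_comm h (H h)]
  simp
  ring

/-- The remainder of the second-order Taylor expansion of `f` at `θ` along the increment `h`. -/
noncomputable def taylorRemainder (f : E → ℝ) (θ h : E) : ℝ :=
  f (θ + h) - f θ - inner ℝ (∇ f θ) h - inner ℝ h (fderiv ℝ (∇ f) θ h) / 2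

lemma abs_taylorRemainder_le {r B : ℝ} (hU : IsOpen U) (hf : ContDiffOn ℝ 2 f U)
    (hball : Metric.ball θ₀ r ⊆ U)
    (hB : ∀ θ ∈ Metric.ball θ₀ r, ‖fderiv ℝ (∇ f) θ - fderiv ℝ (∇ f) θ₀‖ ≤ B) (hh : ‖h‖ < r) :
    |taylorRemainder f θ₀ h| ≤ B * ‖h‖ ^ 2 := by
  set H := fderiv ℝ (∇ f) θ₀ with hH
  have h0 : θ₀ ∈ Metric.ball θ₀ r := Metric.mem_ball_self ((norm_nonneg h).trans_lt hh)
  have hB0 : 0 ≤ B := (norm_nonneg _).trans (hB θ₀ h0)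
  have hnorm {t : ℝ} (ht : t ∈ Set.Icc (0 : ℝ) 1) : ‖t • h‖ ≤ ‖h‖ := by
    rw [norm_smul, Real.norm_of_nonneg ht.1]
    exact mul_le_of_le_one_left (norm_nonneg h) ht.2
  have hmem {t : ℝ} (ht : t ∈ Set.Icc (0 : ℝ) 1) : θ₀ + t • h ∈ Metric.ball θ₀ r := by
    simpa using (hnorm ht).trans_lt hh
  have hgrad {t : ℝ} (ht : t ∈ Set.Icc (0 : ℝ) 1) :
      ‖∇ f (θ₀ + t • h) - ∇ f θ₀ - t • H h‖ ≤ B * ‖h‖ := by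
    have := (convex_ball θ₀ r).norm_image_sub_le_of_norm_hasFDerivWithin_le' (φ := H)
      (fun x hx => (differentiableAt_gradient hU hf (hball hx)).hasFDerivAt.hasFDerivWithinAt)
      hB h0 (hmem ht)
    rw [add_sub_cancel_left, map_smul] at this
    exact this.trans (mul_le_mul_of_nonneg_left (hnorm ht) hB0)
  have hmean := norm_image_sub_le_of_norm_deriv_le_segment_01' (C := B * ‖h‖ ^ 2)
    (fun t ht => (hasDerivAt_comp_line_sub_quadratic (g₀ := ∇ f θ₀) (H := H)
      (differentiableAt_of_contDiffOn_two hU hf (hball (hmem ht))).hasGradientAt).hasDerivWithinAt)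
    (fun t ht => by
      rw [pow_two, ← mul_assoc]
      exact (norm_inner_le_norm _ _).trans
        (mul_le_mul_of_nonneg_right (hgrad ⟨ht.1, ht.2.le⟩) (norm_nonneg h)))
  convert hmean using 1
  simp [taylorRemainder, Real.norm_eq_abs, hH]
  ring_nf

end Taylor

section MeanQuadraticExpansion

variable {𝒵 : Type*} [MeasurableSpace 𝒵] {D : Measure 𝒵}

lemma exists_lintegral_oscillation_lt {T F : Type*} [TopologicalSpace T]
    [SecondCountableTopology T] [NormedAddCommGroup F] [SecondCountableTopology F]
    [MeasurableSpace F] [BorelSpace F] {H : 𝒵 → T → F} {U : Set T} {θ₀ : T} (hU : U ∈ 𝓝 θ₀)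
    (hmeas : ∀ θ ∈ U, Measurable fun z => H z θ) (hcont : ∀ z, ContinuousOn (H z) U)
    (hbound : ∫⁻ z, ⨆ θ ∈ U, ‖H z θ‖ₑ ∂D < ∞) {ε : ℝ≥0∞} (hε : 0 < ε) :
    ∃ V ∈ 𝓝 θ₀, V ⊆ U ∧ ∫⁻ z, ⨆ θ ∈ V, ‖H z θ - H z θ₀‖ₑ ∂D < ε := by
  have hθ₀ := mem_of_mem_nhds hU
  obtain ⟨B, hB⟩ := (𝓝 θ₀).exists_antitone_basis
  set osc : ℕ → 𝒵 → ℝ≥0∞ := fun k z => ⨆ θ ∈ B k ∩ U, ‖H z θ - H z θ₀‖ₑ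
  have hosc_meas (k : ℕ) : Measurable (osc k) := measurable_biSup_of_continuousOn
    (fun z => (((hcont z).mono Set.inter_subset_right).sub continuousOn_const).enorm)
    fun θ hθ => ((hmeas θ hθ.2).sub (hmeas θ₀ hθ₀)).enorm
  have hosc_le (k : ℕ) (z : 𝒵) : osc k z ≤ 2 * ⨆ θ ∈ U, ‖H z θ‖ₑ := iSup₂_le fun θ hθ => by
    have hle {θ : T} (hθ : θ ∈ U) := le_iSup₂ (f := fun θ (_ : θ ∈ U) => ‖H z θ‖ₑ) θ hθ
    rw [two_mul]
    exact enorm_sub_le.trans (add_le_add (hle hθ.2) (hle hθ₀))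
  have hosc_lim (z : 𝒵) : Tendsto (fun k => osc k z) atTop (𝓝 0) := by
    refine ENNReal.tendsto_nhds_zero.mpr fun δ hδ => ?_
    have hc : Tendsto (fun θ => ‖H z θ - H z θ₀‖ₑ) (𝓝 θ₀) (𝓝 0) := by
      simpa using (((hcont z).continuousAt hU).sub (continuousAt_const (y := H z θ₀))).enorm.tendsto
    obtain ⟨k, hk⟩ := hB.mem_iff.mp (hc.eventually (ge_mem_nhds hδ))
    filter_upwards [eventually_ge_atTop k] with j hj
    exact iSup₂_le fun θ hθ => hk (hB.antitone hj hθ.1)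
  have hlim := tendsto_lintegral_of_dominated_convergence (μ := D) _ hosc_meas
    (fun k => ae_of_all _ (hosc_le k))
    (by rw [lintegral_const_mul' _ _ (by simp)]; exact ENNReal.mul_ne_top (by simp) hbound.ne)
    (ae_of_all _ hosc_lim)
  rw [lintegral_zero] at hlim
  obtain ⟨k, hk⟩ := (hlim.eventually (gt_mem_nhds hε)).exists
  exact ⟨B k ∩ U, inter_mem (hB.mem k) hU, Set.inter_subset_right, hk⟩

variable {E : Type*} [NormedAddCommGroup E] [InnerProductSpace ℝ E] [FiniteDimensional ℝ E]
  [MeasurableSpace E] [BorelSpace E] {m : 𝒵 → E → ℝ} {U : Set E} {θ θ₀ : E}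

lemma measurable_gradient_of_contDiffOn (hU : IsOpen U) (hm : ∀ θ ∈ U, Measurable fun z => m z θ)
    (hC2 : ∀ z, ContDiffOn ℝ 2 (m z) U) (hθ : θ ∈ U) : Measurable fun z => ∇ (m z) θ :=
  measurable_gradient_param (hU.mem_nhds hθ) hm
    fun z => differentiableAt_of_contDiffOn_two hU (hC2 z) hθ

lemma measurable_fderiv_gradient_of_contDiffOn (hU : IsOpen U)
    (hm : ∀ θ ∈ U, Measurable fun z => m z θ) (hC2 : ∀ z, ContDiffOn ℝ 2 (m z) U) (hθ : θ ∈ U) :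
    Measurable fun z => fderiv ℝ (∇ (m z)) θ :=
  measurable_fderiv_param (hU.mem_nhds hθ)
    (fun _ hθ' => measurable_gradient_of_contDiffOn hU hm hC2 hθ')
    fun z => differentiableAt_gradient hU (hC2 z) hθ

lemma exists_integrable_taylorRemainder_bound (hU : IsOpen U) (hθ₀ : θ₀ ∈ U)
    (hm : ∀ θ ∈ U, Measurable fun z => m z θ) (hC2 : ∀ z, ContDiffOn ℝ 2 (m z) U)
    (hbound : ∫⁻ z, ⨆ θ ∈ U, ‖fderiv ℝ (∇ (m z)) θ‖ₑ ∂D < ∞) {ε : ℝ} (hε : 0 < ε) :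
    ∃ r > 0, Metric.ball θ₀ r ⊆ U ∧ ∃ w : 𝒵 → ℝ, Measurable w ∧ Integrable w D ∧
      ∫ z, w z ∂D < ε ∧
      ∀ᵐ z ∂D, ∀ h, ‖h‖ < r → |taylorRemainder (m z) θ₀ h| ≤ w z * ‖h‖ ^ 2 := by
  have hHmeas (θ : E) (hθ : θ ∈ U) := measurable_fderiv_gradient_of_contDiffOn hU hm hC2 hθ
  have hHcont (z : 𝒵) : ContinuousOn (fderiv ℝ (∇ (m z))) U :=
    (contDiffOn_gradient hU (hC2 z)).continuousOn_fderiv_of_isOpen hU (by norm_num)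
  obtain ⟨V, hV, hVU, hVlt⟩ := exists_lintegral_oscillation_lt (hU.mem_nhds hθ₀) hHmeas hHcont
    hbound (ENNReal.ofReal_pos.mpr hε)
  obtain ⟨r, hr, hrV⟩ := Metric.mem_nhds_iff.mp hV
  set osc : 𝒵 → ℝ≥0∞ := fun z => ⨆ θ ∈ V, ‖fderiv ℝ (∇ (m z)) θ - fderiv ℝ (∇ (m z)) θ₀‖ₑ
  have hosc_meas : Measurable osc := measurable_biSup_of_continuousOn
    (fun z => (((hHcont z).mono hVU).sub continuousOn_const).enorm)
    fun θ hθ => ((hHmeas θ (hVU hθ)).sub (hHmeas θ₀ hθ₀)).enorm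
  have hosc_fin : ∀ᵐ z ∂D, osc z < ∞ := ae_lt_top hosc_meas (ne_top_of_lt hVlt)
  refine ⟨r, hr, hrV.trans hVU, fun z => (osc z).toReal, hosc_meas.ennreal_toReal,
    integrable_toReal_of_lintegral_ne_top hosc_meas.aemeasurable (ne_top_of_lt hVlt), ?_, ?_⟩
  · rw [integral_toReal hosc_meas.aemeasurable hosc_fin]
    exact ENNReal.toReal_lt_of_lt_ofReal hVlt
  · filter_upwards [hosc_fin] with z hz h hh
    refine abs_taylorRemainder_le hU (hC2 z) (hrV.trans hVU) (fun θ hθ => ?_) hh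
    rw [← toReal_enorm]
    exact ENNReal.toReal_mono hz.ne (le_iSup₂ (f := fun θ (_ : θ ∈ V) =>
      ‖fderiv ℝ (∇ (m z)) θ - fderiv ℝ (∇ (m z)) θ₀‖ₑ) θ (hrV hθ))

end MeanQuadraticExpansion

lemma eq_zero_of_inner_le_mul_norm_sq {E : Type*} [NormedAddCommGroup E] [InnerProductSpace ℝ E]
    {s : E} {C : ℝ} (hs : ∀ᶠ h in 𝓝 0, inner ℝ s h ≤ C * ‖h‖ ^ 2) : s = 0 := by
  have hray : Tendsto (fun t : ℝ => t • s) (𝓝[>] 0) (𝓝 0) :=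
    ((continuous_id.smul continuous_const).tendsto' 0 0 (zero_smul ℝ s)).mono_left
      nhdsWithin_le_nhds
  have hlim : Tendsto (fun t : ℝ => C * t * ‖s‖ ^ 2) (𝓝[>] 0) (𝓝 0) :=
    (Continuous.tendsto' (by fun_prop) 0 0 (by simp)).mono_left nhdsWithin_le_nhds
  have hle : ‖s‖ ^ 2 ≤ 0 := by
    refine ge_of_tendsto hlim ?_
    filter_upwards [hray.eventually hs, self_mem_nhdsWithin] with t ht (ht0 : 0 < t)
    rw [inner_smul_right, real_inner_self_eq_norm_sq, norm_smul, Real.norm_of_nonneg ht0.le] at ht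
    refine le_of_mul_le_mul_left (ht.trans_eq ?_) ht0
    ring
  simpa using hle

lemma abs_inner_apply_self_le {E : Type*} [NormedAddCommGroup E] [InnerProductSpace ℝ E]
    (L : E →L[ℝ] E) (h : E) : |inner ℝ h (L h)| ≤ ‖L‖ * ‖h‖ ^ 2 :=
  calc |inner ℝ h (L h)| ≤ ‖h‖ * ‖L h‖ := abs_real_inner_le_norm _ _
    _ ≤ ‖h‖ * (‖L‖ * ‖h‖) := by gcongr; exact L.le_opNorm h
    _ = ‖L‖ * ‖h‖ ^ 2 := by ring

section RegularCriterion

variable {𝒵 E : Type*} [MeasurableSpace 𝒵] [NormedAddCommGroup E] [InnerProductSpace ℝ E]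
  [FiniteDimensional ℝ E]

/-- The regularity conditions of M-estimation on the criterion `m`, where `D` is the law of one
observation, `Θ` the parameter set and `θ₀` the maximizer of the expected criterion. The criterion
is nonpositive, and its expectation is encoded as minus a Lebesgue integral so that it may be
`-∞` away from `θ₀`. -/
structure IsRegularCriterion (m : 𝒵 → E → ℝ) (Θ : Set E) (D : Measure 𝒵) (θ₀ : E) : Prop where
  isCompact : IsCompact Θ
  mem_interior : θ₀ ∈ interior Θ
  measurable : ∀ θ ∈ Θ, Measurable fun z => m z θ
  nonpos : ∀ z, ∀ θ ∈ Θ, m z θ ≤ 0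
  continuousOn : ∀ z, ContinuousOn (m z) Θ
  contDiffOn : ∀ z, ContDiffOn ℝ 2 (m z) (interior Θ)
  integrable : Integrable (fun z => m z θ₀) D
  unique_max : ∀ θ ∈ Θ, θ ≠ θ₀ →
    ∫⁻ z, ENNReal.ofReal (-m z θ₀) ∂D < ∫⁻ z, ENNReal.ofReal (-m z θ) ∂D
  memLp_gradient : MemLp (fun z => ∇ (m z) θ₀) 2 D
  hessian_bound : ∫⁻ z, ⨆ θ ∈ interior Θ, ‖fderiv ℝ (∇ (m z)) θ‖ₑ ∂D < ∞

namespace IsRegularCriterion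

variable {m : 𝒵 → E → ℝ} {Θ : Set E} {D : Measure 𝒵} {θ₀ θ h : E}

lemma measurable_of_mem_interior (hm : IsRegularCriterion m Θ D θ₀) (hθ : θ ∈ interior Θ) :
    Measurable fun z => m z θ :=
  hm.measurable θ (interior_subset hθ)

lemma integrable_gradient [IsFiniteMeasure D] (hm : IsRegularCriterion m Θ D θ₀) :
    Integrable (fun z => ∇ (m z) θ₀) D :=
  hm.memLp_gradient.integrable one_le_two

lemma integral_le (hm : IsRegularCriterion m Θ D θ₀) (hθ : θ ∈ Θ)
    (hint : Integrable (fun z => m z θ) D) : ∫ z, m z θ ∂D ≤ ∫ z, m z θ₀ ∂D := by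
  have hθ₀ := interior_subset hm.mem_interior
  have hneg {θ : E} (hθ : θ ∈ Θ) : 0 ≤ᵐ[D] fun z => -m z θ :=
    ae_of_all _ fun z => neg_nonneg.mpr (hm.nonpos z θ hθ)
  rcases eq_or_ne θ θ₀ with rfl | hne
  · exact le_rfl
  have hlt := hm.unique_max θ hθ hne
  rw [← ofReal_integral_eq_lintegral_ofReal (f := fun z => -m z θ₀) hm.integrable.neg (hneg hθ₀),
    ← ofReal_integral_eq_lintegral_ofReal (f := fun z => -m z θ) hint.neg (hneg hθ),
    ENNReal.ofReal_lt_ofReal_iff_of_nonneg (integral_nonneg_of_ae (hneg hθ₀)), integral_neg,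
    integral_neg, neg_lt_neg_iff] at hlt
  exact hlt.le

variable [MeasurableSpace E] [BorelSpace E]

lemma measurable_gradient (hm : IsRegularCriterion m Θ D θ₀) :
    Measurable fun z => ∇ (m z) θ₀ :=
  measurable_gradient_of_contDiffOn isOpen_interior (fun _ => hm.measurable_of_mem_interior)
    hm.contDiffOn hm.mem_interior

lemma measurable_hessian (hm : IsRegularCriterion m Θ D θ₀) :
    Measurable fun z => fderiv ℝ (∇ (m z)) θ₀ :=
  measurable_fderiv_gradient_of_contDiffOn isOpen_interior
    (fun _ => hm.measurable_of_mem_interior) hm.contDiffOn hm.mem_interior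

lemma integrable_hessian (hm : IsRegularCriterion m Θ D θ₀) :
    Integrable (fun z => fderiv ℝ (∇ (m z)) θ₀) D :=
  ⟨hm.measurable_hessian.aestronglyMeasurable, (lintegral_mono fun z =>
    le_iSup₂ (f := fun θ (_ : θ ∈ interior Θ) => ‖fderiv ℝ (∇ (m z)) θ‖ₑ) θ₀
      hm.mem_interior).trans_lt hm.hessian_bound⟩

lemma integrable_taylorRemainder (hm : IsRegularCriterion m Θ D θ₀) (hh : θ₀ + h ∈ interior Θ)
    {w : 𝒵 → ℝ} (hw : Integrable w D) (hle : ∀ᵐ z ∂D, |taylorRemainder (m z) θ₀ h| ≤ w z) :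
    Integrable (fun z => taylorRemainder (m z) θ₀ h) D := by
  refine hw.mono' (Measurable.aestronglyMeasurable ?_) hle
  exact (((hm.measurable_of_mem_interior hh).sub
    (hm.measurable_of_mem_interior hm.mem_interior)).sub hm.measurable_gradient.inner_const).sub
    ((hm.measurable_hessian.apply_continuousLinearMap h).const_inner.div_const 2)

variable [IsFiniteMeasure D]

lemma integrable_add (hm : IsRegularCriterion m Θ D θ₀) (hh : θ₀ + h ∈ interior Θ)
    {w : 𝒵 → ℝ} (hw : Integrable w D) (hle : ∀ᵐ z ∂D, |taylorRemainder (m z) θ₀ h| ≤ w z) :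
    Integrable (fun z => m z (θ₀ + h)) D := by
  have hquad : Integrable (fun z => inner ℝ h (fderiv ℝ (∇ (m z)) θ₀ h) / 2) D :=
    ((hm.integrable_hessian.apply_continuousLinearMap h).const_inner h).div_const 2
  refine (((hm.integrable.add (hm.integrable_gradient.inner_const h)).add hquad).add
    (hm.integrable_taylorRemainder hh hw hle)).congr (ae_of_all _ fun z => ?_)
  simp only [Pi.add_apply, taylorRemainder]
  ring

lemma inner_integral_gradient_le (hm : IsRegularCriterion m Θ D θ₀) (hh : θ₀ + h ∈ interior Θ)
    {w : 𝒵 → ℝ} (hw : Integrable w D)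
    (hle : ∀ᵐ z ∂D, |taylorRemainder (m z) θ₀ h| ≤ w z * ‖h‖ ^ 2) :
    inner ℝ (∫ z, ∇ (m z) θ₀ ∂D) h ≤
      (∫ z, (‖fderiv ℝ (∇ (m z)) θ₀‖ / 2 + w z) ∂D) * ‖h‖ ^ 2 := by
  have hint : Integrable (fun z => m z (θ₀ + h) - m z θ₀) D :=
    (hm.integrable_add hh (hw.mul_const _) hle).sub hm.integrable
  have hbound : Integrable (fun z => (‖fderiv ℝ (∇ (m z)) θ₀‖ / 2 + w z) * ‖h‖ ^ 2) D :=
    ((hm.integrable_hessian.norm.div_const 2).add hw).mul_const _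
  have hpoint : ∀ᵐ z ∂D, inner ℝ (∇ (m z) θ₀) h ≤ m z (θ₀ + h) - m z θ₀ +
      (‖fderiv ℝ (∇ (m z)) θ₀‖ / 2 + w z) * ‖h‖ ^ 2 := by
    filter_upwards [hle] with z hz
    have hrem := (abs_le.mp hz).1
    rw [taylorRemainder] at hrem
    linarith [(abs_le.mp (abs_inner_apply_self_le (fderiv ℝ (∇ (m z)) θ₀) h)).1]
  have hmax : ∫ z, (m z (θ₀ + h) - m z θ₀) ∂D ≤ 0 := by
    rw [integral_sub (hm.integrable_add hh (hw.mul_const _) hle) hm.integrable]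
    linarith [hm.integral_le (interior_subset hh) (hm.integrable_add hh (hw.mul_const _) hle)]
  calc inner ℝ (∫ z, ∇ (m z) θ₀ ∂D) h = ∫ z, inner ℝ (∇ (m z) θ₀) h ∂D := by
        simp_rw [real_inner_comm h]
        exact (integral_inner hm.integrable_gradient h).symm
    _ ≤ ∫ z, (m z (θ₀ + h) - m z θ₀ + (‖fderiv ℝ (∇ (m z)) θ₀‖ / 2 + w z) * ‖h‖ ^ 2) ∂D :=
        integral_mono_ae (hm.integrable_gradient.inner_const h) (hint.add hbound) hpoint
    _ ≤ (∫ z, (‖fderiv ℝ (∇ (m z)) θ₀‖ / 2 + w z) ∂D) * ‖h‖ ^ 2 := by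
        rw [integral_add hint hbound, integral_mul_const]
        linarith

lemma integral_gradient_eq_zero (hm : IsRegularCriterion m Θ D θ₀) :
    ∫ z, ∇ (m z) θ₀ ∂D = 0 := by
  obtain ⟨r, hr, hball, w, -, hw, -, hle⟩ := exists_integrable_taylorRemainder_bound
    isOpen_interior hm.mem_interior (fun _ => hm.measurable_of_mem_interior) hm.contDiffOn
    hm.hessian_bound one_pos
  refine eq_zero_of_inner_le_mul_norm_sq
    (C := ∫ z, (‖fderiv ℝ (∇ (m z)) θ₀‖ / 2 + w z) ∂D) ?_
  filter_upwards [Metric.ball_mem_nhds 0 hr] with h hh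
  have hhr : ‖h‖ < r := by simpa using hh
  exact hm.inner_integral_gradient_le (hball (by simpa using hhr)) hw
    (hle.mono fun z hz => hz h hhr)

end IsRegularCriterion

end RegularCriterion

section SampleExpansion

variable {Ω 𝒵 E : Type*} [NormedAddCommGroup E] [InnerProductSpace ℝ E] [FiniteDimensional ℝ E]
  {m : 𝒵 → E → ℝ} {θ₀ : E} {Z : ℕ → Ω → 𝒵}

lemma sampleMean_taylorRemainder (h : E) (q : ℕ × Ω) :
    sampleMean Z (fun z => taylorRemainder (m z) θ₀ h) q =
      sampleMean Z (fun z => m z (θ₀ + h)) q - sampleMean Z (fun z => m z θ₀) q -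
        inner ℝ (sampleMean Z (fun z => ∇ (m z) θ₀) q) h -
        inner ℝ h (sampleMean Z (fun z => fderiv ℝ (∇ (m z)) θ₀) q h) / 2 := by
  simp only [taylorRemainder, sampleMean, Finset.sum_sub_distrib, sum_inner, inner_sum,
    inner_smul_left, inner_smul_right, smul_apply, sum_apply, ← Finset.sum_div,
    RCLike.conj_to_real, smul_eq_mul]
  ring

variable [MeasurableSpace Ω] [MeasurableSpace 𝒵] [MeasurableSpace E] [BorelSpace E]
  {μ : Measure Ω} [IsProbabilityMeasure μ] {D : Measure 𝒵} {Θ : Set E} {A : E →L[ℝ] E}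

lemma eventually_abs_sampleMean_taylorRemainder_le (hindep : iIndepFun Z μ)
    (hlaw : ∀ i, HasLaw (Z i) D μ) (hm : IsRegularCriterion m Θ D θ₀) {ε : ℝ} (hε : 0 < ε) :
    ∀ᶠ p in highProb atTop μ ×ˢ 𝓝 (0 : E),
      |sampleMean Z (fun z => taylorRemainder (m z) θ₀ p.2) p.1| ≤ ε * ‖p.2‖ ^ 2 := by
  obtain ⟨r, hr, -, w, hw_meas, hw, hw_lt, hle⟩ := exists_integrable_taylorRemainder_bound
    isOpen_interior hm.mem_interior (fun _ => hm.measurable_of_mem_interior) hm.contDiffOn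
    hm.hessian_bound hε
  have hgood : ∀ᵐ ω ∂μ, ∀ i, ∀ h, ‖h‖ < r →
      |taylorRemainder (m (Z i ω)) θ₀ h| ≤ w (Z i ω) * ‖h‖ ^ 2 := by
    refine ae_all_iff.mpr fun i => ?_
    rw [← (hlaw i).map_eq] at hle
    exact ae_of_ae_map (hlaw i).aemeasurable hle
  have hsmall : ∀ᶠ h : E in 𝓝 0, ‖h‖ < r :=
    (continuous_norm.tendsto' 0 0 norm_zero).eventually (gt_mem_nhds hr)
  have hmean := (tendsto_sampleMean hindep hlaw hw_meas hw).eventually (gt_mem_nhds hw_lt)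
  filter_upwards [((tendsto_snd_highProb.eventually hgood).and hmean).prod_inl (𝓝 0),
    hsmall.prod_inr _] with ⟨q, h⟩ ⟨hq, hwq⟩ hh
  calc |sampleMean Z (fun z => taylorRemainder (m z) θ₀ h) q|
      ≤ sampleMean Z (fun z => w z * ‖h‖ ^ 2) q :=
        abs_sampleMean_le fun i => hq i h hh
    _ = sampleMean Z w q * ‖h‖ ^ 2 := by
        simp only [sampleMean, smul_eq_mul, ← Finset.sum_mul, mul_assoc]
    _ ≤ ε * ‖h‖ ^ 2 := by gcongr

lemma isLittleO_sampleMean_sub_quadratic (hindep : iIndepFun Z μ)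
    (hlaw : ∀ i, HasLaw (Z i) D μ) (hm : IsRegularCriterion m Θ D θ₀)
    (hA : ∀ h, ∫ z, inner ℝ h (fderiv ℝ (∇ (m z)) θ₀ h) ∂D = -inner ℝ h (A h)) :
    (fun p : (ℕ × Ω) × E => sampleMean Z (fun z => m z (θ₀ + p.2)) p.1 -
      sampleMean Z (fun z => m z θ₀) p.1 -
      (inner ℝ (sampleMean Z (fun z => ∇ (m z) θ₀) p.1) p.2 - inner ℝ p.2 (A p.2) / 2))
      =o[highProb atTop μ ×ˢ 𝓝 0] fun p => ‖p.2‖ ^ 2 := by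
  refine Asymptotics.isLittleO_iff.mpr fun ε hε => ?_
  set H : 𝒵 → E →L[ℝ] E := fun z => fderiv ℝ (∇ (m z)) θ₀
  have hmeanA (h : E) : inner ℝ h ((∫ z, H z ∂D) h) = -inner ℝ h (A h) := by
    rw [← hA h, ContinuousLinearMap.integral_apply hm.integrable_hessian, integral_inner]
    exact hm.integrable_hessian.apply_continuousLinearMap h
  have hHess : ∀ᶠ q in highProb atTop μ, ‖sampleMean Z H q - ∫ z, H z ∂D‖ < ε := by
    simpa only [dist_eq_norm] using Metric.tendsto_nhds.mp
      (tendsto_sampleMean hindep hlaw hm.measurable_hessian hm.integrable_hessian) ε hε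
  filter_upwards [eventually_abs_sampleMean_taylorRemainder_le hindep hlaw hm (half_pos hε),
    hHess.prod_inl (𝓝 0)] with ⟨q, h⟩ hrem hq
  rw [sampleMean_taylorRemainder] at hrem
  have hquad : |inner ℝ h ((sampleMean Z H q - ∫ z, H z ∂D) h)| ≤ ε * ‖h‖ ^ 2 :=
    (abs_inner_apply_self_le _ h).trans (by gcongr)
  rw [sub_apply, inner_sub_right, hmeanA] at hquad
  rw [Real.norm_eq_abs, norm_pow, norm_norm, abs_le]
  constructor <;> linarith [abs_le.mp hrem, abs_le.mp hquad]

end SampleExpansion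

section QuadraticMaximizer

variable {E : Type*} [NormedAddCommGroup E] [InnerProductSpace ℝ E] {A : E →L[ℝ] E} {c : ℝ}

lemma inner_sub_inner_self_div_two (hA : (A : E →ₗ[ℝ] E).IsSymmetric) (x h : E) :
    inner ℝ (A x) h - inner ℝ h (A h) / 2 =
      inner ℝ x (A x) / 2 - inner ℝ (h - x) (A (h - x)) / 2 := by
  have hsymm : inner ℝ (A x) h = inner ℝ x (A h) := hA x h
  have hcomm : inner ℝ (A x) h = inner ℝ h (A x) := real_inner_comm _ _
  simp only [map_sub, inner_sub_left, inner_sub_right]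
  linarith

lemma norm_sub_sq_le_of_quadratic_expansion {η τ Gu Gx : ℝ} {x u : E}
    (hA : (A : E →ₗ[ℝ] E).IsSymmetric) (hc : ∀ v, c * ‖v‖ ^ 2 ≤ inner ℝ v (A v))
    (hη : 0 ≤ η) (hηc : 8 * η ≤ c)
    (hGu : |Gu - (inner ℝ (A x) u - inner ℝ u (A u) / 2)| ≤ η * ‖u‖ ^ 2)
    (hGx : |Gx - (inner ℝ (A x) x - inner ℝ x (A x) / 2)| ≤ η * ‖x‖ ^ 2)
    (hmax : Gx ≤ Gu + η * τ) :
    c / 4 * ‖u - x‖ ^ 2 ≤ η * (3 * ‖x‖ ^ 2 + τ) := by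
  have hnorm : ‖u‖ ^ 2 ≤ 2 * ‖u - x‖ ^ 2 + 2 * ‖x‖ ^ 2 := by
    have htri : ‖u‖ ≤ ‖u - x‖ + ‖x‖ := by simpa using norm_add_le (u - x) x
    calc ‖u‖ ^ 2 ≤ (‖u - x‖ + ‖x‖) ^ 2 := by gcongr
      _ ≤ 2 * ‖u - x‖ ^ 2 + 2 * ‖x‖ ^ 2 := by linarith [add_sq_le (a := ‖u - x‖) (b := ‖x‖)]
  rw [inner_sub_inner_self_div_two hA] at hGu hGx
  rw [sub_self, map_zero, inner_zero_right, zero_div, sub_zero] at hGx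
  have hgap : c / 2 * ‖u - x‖ ^ 2 ≤ η * (‖u‖ ^ 2 + ‖x‖ ^ 2 + τ) := by
    linarith [hc (u - x), (abs_le.mp hGu).2, (abs_le.mp hGx).1]
  have hηu : η * ‖u‖ ^ 2 ≤ η * (2 * ‖u - x‖ ^ 2 + 2 * ‖x‖ ^ 2) := by gcongr
  have hηux : 8 * η * ‖u - x‖ ^ 2 ≤ c * ‖u - x‖ ^ 2 := by gcongr
  linarith

lemma eventually_norm_sub_sq_le_of_quadratic_expansion {Q : Type*} {F : Filter Q}
    {G : Q → E → ℝ} {x u : Q → E} {τ : Q → ℝ} (hA : (A : E →ₗ[ℝ] E).IsSymmetric) (hc₀ : 0 < c)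
    (hc : ∀ v, c * ‖v‖ ^ 2 ≤ inner ℝ v (A v))
    (hexp : (fun p : Q × E => G p.1 p.2 - (inner ℝ (A (x p.1)) p.2 - inner ℝ p.2 (A p.2) / 2))
      =o[F ×ˢ 𝓝 0] fun p => ‖p.2‖ ^ 2)
    (hx : Tendsto x F (𝓝 0)) (hu : Tendsto u F (𝓝 0)) (hτ : ∀ q, 0 ≤ τ q)
    (hmax : ∀ κ > 0, ∀ᶠ q in F, G q (x q) ≤ G q (u q) + κ * τ q) {κ : ℝ} (hκ : 0 < κ) :
    ∀ᶠ q in F, ‖u q - x q‖ ^ 2 ≤ κ * (‖x q‖ ^ 2 + τ q) := by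
  obtain ⟨η, hη, hηc, hηκ⟩ : ∃ η > 0, 8 * η ≤ c ∧ 12 * η ≤ c * κ :=
    ⟨min (c / 8) (c * κ / 12), by positivity, by linarith [min_le_left (c / 8) (c * κ / 12)],
      by linarith [min_le_right (c / 8) (c * κ / 12)]⟩
  have hbound {v : Q → E} (hv : Tendsto v F (𝓝 0)) : ∀ᶠ q in F,
      |G q (v q) - (inner ℝ (A (x q)) (v q) - inner ℝ (v q) (A (v q)) / 2)| ≤ η * ‖v q‖ ^ 2 := by
    simpa using (tendsto_id.prodMk hv).eventually (Asymptotics.isLittleO_iff.mp hexp hη)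
  filter_upwards [hbound hu, hbound hx, hmax η hη] with q hGu hGx hq
  have hquad := norm_sub_sq_le_of_quadratic_expansion hA hc hη.le hηc hGu hGx hq
  have hηx : η * (3 * ‖x q‖ ^ 2 + τ q) ≤ 3 * η * (‖x q‖ ^ 2 + τ q) := by
    linarith [mul_nonneg hη.le (hτ q)]
  have hκx : 12 * η * (‖x q‖ ^ 2 + τ q) ≤ c * κ * (‖x q‖ ^ 2 + τ q) :=
    mul_le_mul_of_nonneg_right hηκ (add_nonneg (sq_nonneg _) (hτ q))
  exact le_of_mul_le_mul_left (by linarith) hc₀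

end QuadraticMaximizer

section AsymptoticLinearity

variable {Ω 𝒵 E : Type*} [MeasurableSpace Ω] [MeasurableSpace 𝒵] [NormedAddCommGroup E]
  [InnerProductSpace ℝ E] [FiniteDimensional ℝ E]
  {m : 𝒵 → E → ℝ} {Θ : Set E} {θ₀ : E} {Z : ℕ → Ω → 𝒵} {μ : Measure Ω} [IsProbabilityMeasure μ]
  {D : Measure 𝒵} [IsFiniteMeasure D] {u : ℕ × Ω → E}

lemma tendsto_near_argmax_sampleMean (hindep : iIndepFun Z μ) (hlaw : ∀ i, HasLaw (Z i) D μ)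
    (hm : IsRegularCriterion m Θ D θ₀) (hu : ∀ᶠ q in highProb atTop μ, u q ∈ Θ)
    (hnear : ∀ κ > 0, ∀ᶠ q in highProb atTop μ, ∀ θ ∈ Θ, sampleMean Z (fun z => m z θ) q ≤
      sampleMean Z (fun z => m z (u q)) q + κ * (q.1 : ℝ)⁻¹) :
    Tendsto u (highProb atTop μ) (𝓝 θ₀) := by
  refine tendsto_approx_argmax_sampleMean hindep hlaw hm.isCompact hm.measurable hm.continuousOn
    hm.nonpos (interior_subset hm.mem_interior) hm.integrable hm.unique_max hu fun δ hδ => ?_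
  filter_upwards [hnear δ hδ, tendsto_fst_highProb.eventually (eventually_ge_atTop 1)] with q hq hn
  have hn' : (1 : ℝ) ≤ q.1 := by exact_mod_cast hn
  calc _ ≤ _ := hq θ₀ (interior_subset hm.mem_interior)
    _ ≤ _ := by gcongr; exact mul_le_of_le_one_right hδ.le (inv_le_one_of_one_le₀ hn')

variable [MeasurableSpace E] [BorelSpace E] {A B : E →L[ℝ] E}

lemma tendsto_sampleMean_gradient_zero (hindep : iIndepFun Z μ) (hlaw : ∀ i, HasLaw (Z i) D μ)
    (hm : IsRegularCriterion m Θ D θ₀) (B : E →L[ℝ] E) :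
    Tendsto (sampleMean Z fun z => B (∇ (m z) θ₀)) (highProb atTop μ) (𝓝 0) := by
  have hmean : ∫ z, B (∇ (m z) θ₀) ∂D = 0 := by
    rw [B.integral_comp_comm hm.integrable_gradient, hm.integral_gradient_eq_zero, map_zero]
  rw [← hmean]
  exact tendsto_sampleMean hindep hlaw (B.continuous.measurable.comp hm.measurable_gradient)
    (B.integrable_comp hm.integrable_gradient)

lemma eventually_norm_sub_sampleMean_gradient_sq_le (hindep : iIndepFun Z μ)
    (hlaw : ∀ i, HasLaw (Z i) D μ) (hm : IsRegularCriterion m Θ D θ₀)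
    (hA : (A : E →ₗ[ℝ] E).IsSymmetric) (hcoer : ∃ c > 0, ∀ v, c * ‖v‖ ^ 2 ≤ inner ℝ v (A v))
    (hAB : ∀ v, A (B v) = v)
    (hmean : ∀ h, ∫ z, inner ℝ h (fderiv ℝ (∇ (m z)) θ₀ h) ∂D = -inner ℝ h (A h))
    (hu : ∀ᶠ q in highProb atTop μ, u q ∈ Θ)
    (hnear : ∀ κ > 0, ∀ᶠ q in highProb atTop μ, ∀ θ ∈ Θ, sampleMean Z (fun z => m z θ) q ≤
      sampleMean Z (fun z => m z (u q)) q + κ * (q.1 : ℝ)⁻¹) {κ : ℝ} (hκ : 0 < κ) :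
    ∀ᶠ q in highProb atTop μ, ‖u q - θ₀ - sampleMean Z (fun z => B (∇ (m z) θ₀)) q‖ ^ 2 ≤
      κ * (‖sampleMean Z (fun z => B (∇ (m z) θ₀)) q‖ ^ 2 + (q.1 : ℝ)⁻¹) := by
  obtain ⟨c, hc₀, hc⟩ := hcoer
  have hX := tendsto_sampleMean_gradient_zero hindep hlaw hm B
  have hinterior : ∀ᶠ q in highProb atTop μ,
      θ₀ + sampleMean Z (fun z => B (∇ (m z) θ₀)) q ∈ interior Θ :=
    (hX.const_add θ₀).eventually (by
      simpa using isOpen_interior.mem_nhds hm.mem_interior)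
  have hu₀ : Tendsto (fun q => u q - θ₀) (highProb atTop μ) (𝓝 0) := by
    simpa using (tendsto_near_argmax_sampleMean hindep hlaw hm hu hnear).sub_const θ₀
  refine eventually_norm_sub_sq_le_of_quadratic_expansion (G := fun q h =>
    sampleMean Z (fun z => m z (θ₀ + h)) q - sampleMean Z (fun z => m z θ₀) q) hA hc₀ hc ?_ hX hu₀
    (fun q => by positivity) (fun κ hκ => ?_) hκ
  · simp only [← map_sampleMean A, hAB]
    exact isLittleO_sampleMean_sub_quadratic hindep hlaw hm hmean
  · filter_upwards [hnear κ hκ, hinterior] with q hq hmem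
    rw [add_sub_cancel]
    linarith [hq _ (interior_subset hmem)]

end AsymptoticLinearity

section EuclideanMatrix

variable {ι : Type*} [Fintype ι] [DecidableEq ι] {H : Matrix ι ι ℝ}

lemma isSymmetric_toEuclideanCLM (hH : H.IsHermitian) :
    (Matrix.toEuclideanCLM (𝕜 := ℝ) H : EuclideanSpace ℝ ι →ₗ[ℝ] EuclideanSpace ℝ ι).IsSymmetric :=
  Matrix.isSymmetric_toEuclideanLin_iff.mpr hH

lemma toEuclideanCLM_apply_inv_apply (hH : IsUnit H) (v : EuclideanSpace ℝ ι) :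
    Matrix.toEuclideanCLM (𝕜 := ℝ) H (Matrix.toEuclideanCLM (𝕜 := ℝ) H⁻¹ v) = v := by
  rw [← mul_apply_eq_comp, ← map_mul,
    Matrix.mul_nonsing_inv H ((Matrix.isUnit_iff_isUnit_det H).mp hH), map_one, one_apply_eq_self]

lemma exists_mul_norm_sq_le_inner_toEuclideanCLM (hH : H.PosDef) :
    ∃ c > 0, ∀ v, c * ‖v‖ ^ 2 ≤ inner ℝ v (Matrix.toEuclideanCLM (𝕜 := ℝ) H v) := by
  cases isEmpty_or_nonempty ι
  · exact ⟨1, one_pos, fun v => by simp [Subsingleton.elim v 0]⟩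
  obtain ⟨c, hc, hle⟩ := (CFC.exists_pos_algebraMap_le_iff hH.isHermitian).mpr fun _ hx =>
    hH.isStrictlyPositive.spectrum_pos hx
  refine ⟨c, hc, fun v => ?_⟩
  have hnonneg := (Matrix.le_iff.mp hle).dotProduct_mulVec_nonneg v.ofLp
  have hnorm : ‖v‖ ^ 2 = v.ofLp ⬝ᵥ v.ofLp := by
    rw [EuclideanSpace.real_norm_sq_eq]
    simp only [dotProduct, pow_two]
  rw [Matrix.inner_toEuclideanCLM, hnorm]
  simpa [Matrix.sub_mulVec, Algebra.algebraMap_eq_smul_one, Matrix.smul_mulVec] using hnonneg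

end EuclideanMatrix

lemma eventually_near_argmax_of_isLittleOInProb {Ω T : Type*} [MeasurableSpace Ω]
    {μ : Measure Ω} {Θ : Set T} {ℓ L : ℕ → Ω → T → ℝ}
    {that : ℕ → Ω → T} {α : ℝ} (hα : 1 ≤ α)
    (happrox : IsLittleOInProb μ (fun n ω => ⨆ θ ∈ Θ, ENNReal.ofReal |L n ω θ - ℓ n ω θ|)
      (fun n => (n : ℝ) ^ (-α)))
    (hmem : ∀ n, ∀ᵐ ω ∂μ, that n ω ∈ Θ)
    (hmax : IsLittleOInProb μ
      (fun n ω => ⨆ θ ∈ Θ, ENNReal.ofReal (L n ω θ - L n ω (that n ω))) (fun n => (n : ℝ)⁻¹))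
    {κ : ℝ} (hκ : 0 < κ) :
    ∀ᶠ q in highProb atTop μ, ∀ θ ∈ Θ,
      ℓ q.1 q.2 θ ≤ ℓ q.1 q.2 (that q.1 q.2) + κ * (q.1 : ℝ)⁻¹ := by
  have hmem' : ∀ᶠ q in highProb atTop μ, that q.1 q.2 ∈ Θ :=
    eventually_highProb_of_ae (Eventually.of_forall hmem)
  filter_upwards [isLittleOInProb_iff.mp happrox (κ / 3) (by positivity),
    isLittleOInProb_iff.mp hmax (κ / 3) (by positivity), hmem',
    tendsto_fst_highProb.eventually (eventually_ge_atTop 1)] with q hclose hbest ht hn θ hθ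
  have hrate : (q.1 : ℝ) ^ (-α) ≤ (q.1 : ℝ)⁻¹ := by
    rw [← Real.rpow_neg_one]
    exact Real.rpow_le_rpow_of_exponent_le (by exact_mod_cast hn) (neg_le_neg hα)
  have hdist {t : T} (ht : t ∈ Θ) : |L q.1 q.2 t - ℓ q.1 q.2 t| ≤ κ / 3 * (q.1 : ℝ)⁻¹ :=
    ((ENNReal.ofReal_le_ofReal_iff (by positivity)).mp (iSup₂_le_iff.mp hclose t ht)).trans
      (by gcongr)
  have hgap := (ENNReal.ofReal_le_ofReal_iff (by positivity)).mp (iSup₂_le_iff.mp hbest θ hθ)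
  linarith [(abs_le.mp (hdist hθ)).1, (abs_le.mp (hdist ht)).2]

section AsymptoticNormality

variable {Ω 𝒵 ι : Type*} [MeasurableSpace Ω] [MeasurableSpace 𝒵] [Fintype ι] [DecidableEq ι]
  {m : 𝒵 → EuclideanSpace ℝ ι → ℝ} {Θ : Set (EuclideanSpace ℝ ι)} {θ₀ : EuclideanSpace ℝ ι}
  {Z : ℕ → Ω → 𝒵} {μ : Measure Ω} [IsProbabilityMeasure μ] {D : Measure 𝒵} [IsFiniteMeasure D]
  {H : Matrix ι ι ℝ} {θhat : ℕ → Ω → EuclideanSpace ℝ ι}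

lemma tendstoInDistribution_sqrt_smul_sampleMean_gradient (hindep : iIndepFun Z μ)
    (hlaw : ∀ i, HasLaw (Z i) D μ) (hm : IsRegularCriterion m Θ D θ₀) (S : Matrix ι ι ℝ) :
    TendstoInDistribution (fun (n : ℕ) ω => √(n : ℝ) •
        sampleMean Z (fun z => Matrix.toEuclideanCLM (𝕜 := ℝ) S (∇ (m z) θ₀)) (n, ω)) atTop id
      (fun _ => μ)
      (multivariateGaussian 0 (S * secondMoment (fun z => ∇ (m z) θ₀) D * S.transpose)) := by
  simp only [sampleMean, smul_smul, ← div_eq_mul_inv, Real.sqrt_div_self]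
  rw [← secondMoment_toEuclideanCLM hm.memLp_gradient]
  refine tendstoInDistribution_sum_multivariateGaussian hindep hlaw
    ((Matrix.toEuclideanCLM (𝕜 := ℝ) S).continuous.measurable.comp hm.measurable_gradient)
    ((Matrix.toEuclideanCLM (𝕜 := ℝ) S).comp_memLp' hm.memLp_gradient) ?_
  simp only [Function.comp_apply]
  rw [ContinuousLinearMap.integral_comp_comm _ hm.integrable_gradient,
    hm.integral_gradient_eq_zero, map_zero]

lemma tendstoInDistribution_near_argmax_sampleMean (hindep : iIndepFun Z μ)
    (hlaw : ∀ i, HasLaw (Z i) D μ) (hm : IsRegularCriterion m Θ D θ₀) (hH : H.PosDef)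
    (hmean : ∀ t : EuclideanSpace ℝ ι,
      ∫ z, inner ℝ t (fderiv ℝ (∇ (m z)) θ₀ t) ∂D = -(t.ofLp ⬝ᵥ H.mulVec t.ofLp))
    (hmeas : ∀ n, AEMeasurable (θhat n) μ) (hmem : ∀ n, ∀ᵐ ω ∂μ, θhat n ω ∈ Θ)
    (hnear : ∀ κ > 0, ∀ᶠ q in highProb atTop μ, ∀ θ ∈ Θ, sampleMean Z (fun z => m z θ) q ≤
      sampleMean Z (fun z => m z (θhat q.1 q.2)) q + κ * (q.1 : ℝ)⁻¹) :
    TendstoInDistribution (fun (n : ℕ) ω => √(n : ℝ) • (θhat n ω - θ₀)) atTop id (fun _ => μ)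
      (multivariateGaussian 0 (H⁻¹ * secondMoment (fun z => ∇ (m z) θ₀) D * H⁻¹)) := by
  set X : ℕ × Ω → EuclideanSpace ℝ ι :=
    sampleMean Z fun z => Matrix.toEuclideanCLM (𝕜 := ℝ) H⁻¹ (∇ (m z) θ₀)
  have hclt := tendstoInDistribution_sqrt_smul_sampleMean_gradient hindep hlaw hm H⁻¹
  have hsymm : H⁻¹.transpose = H⁻¹ := by simpa [Matrix.IsHermitian] using hH.inv.isHermitian
  rw [hsymm] at hclt
  have hmem' : ∀ᶠ q in highProb atTop μ, θhat q.1 q.2 ∈ Θ :=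
    eventually_highProb_of_ae (Eventually.of_forall hmem)
  refine tendstoInDistribution_of_tendstoInMeasure_sub _ _ hclt ?_
    fun n => AEMeasurable.const_smul ((hmeas n).sub_const θ₀) (√(n : ℝ))
  refine tendstoInMeasure_const_iff.mpr (tendsto_highProb_zero_of_norm_sq_le
    (fun ε hε => exists_measure_norm_ge_le_of_tendstoInDistribution hclt hε) fun κ hκ => ?_)
  filter_upwards [eventually_norm_sub_sampleMean_gradient_sq_le hindep hlaw hm
    (isSymmetric_toEuclideanCLM hH.isHermitian) (exists_mul_norm_sq_le_inner_toEuclideanCLM hH)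
    (toEuclideanCLM_apply_inv_apply hH.isUnit)
    (fun t => by rw [hmean, Matrix.inner_toEuclideanCLM]) hmem' hnear hκ] with q hq
  have hsqrt (x : EuclideanSpace ℝ ι) : ‖√(q.1 : ℝ) • x‖ ^ 2 = q.1 * ‖x‖ ^ 2 := by
    rw [norm_smul, mul_pow, Real.norm_of_nonneg (Real.sqrt_nonneg _), Real.sq_sqrt (by positivity)]
  rw [Pi.sub_apply, Pi.sub_apply, ← smul_sub, hsqrt, hsqrt]
  calc (q.1 : ℝ) * ‖θhat q.1 q.2 - θ₀ - X q‖ ^ 2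
      ≤ q.1 * (κ * (‖X q‖ ^ 2 + (q.1 : ℝ)⁻¹)) := by gcongr
    _ = κ * (q.1 * ‖X q‖ ^ 2 + q.1 * (q.1 : ℝ)⁻¹) := by ring
    _ ≤ κ * (q.1 * ‖X q‖ ^ 2 + 1) := by gcongr; exact mul_inv_le_one

end AsymptoticNormality

section Bartlett

variable {κ E : Type*} [Fintype κ] [NormedAddCommGroup E] [InnerProductSpace ℝ E]
  [CompleteSpace E] {ℓ : κ → E → ℝ} {U : Set E} {θ : E}

lemma sum_exp_mul_inner_gradient (hℓ : ∀ j, DifferentiableAt ℝ (ℓ j) θ)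
    (hsum : ∀ᶠ θ' in 𝓝 θ, ∑ j, Real.exp (ℓ j θ') = 1) (h : E) :
    ∑ j, Real.exp (ℓ j θ) * inner ℝ h (∇ (ℓ j) θ) = 0 := by
  have hderiv : HasFDerivAt (fun θ => ∑ j, Real.exp (ℓ j θ)) _ θ :=
    .fun_sum fun j _ => (hℓ j).hasGradientAt.hasFDerivAt.exp
  have hzero := hderiv.unique ((hasFDerivAt_const (1 : ℝ) θ).congr_of_eventuallyEq hsum)
  simpa [sum_apply, real_inner_comm] using congrArg (fun L => L h) hzero

lemma sum_exp_mul_inner_gradient_sq_add_hessian (hU : IsOpen U)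
    (hℓ : ∀ j, ContDiffOn ℝ 2 (ℓ j) U) (hsum : ∀ θ ∈ U, ∑ j, Real.exp (ℓ j θ) = 1)
    (hθ : θ ∈ U) (h : E) :
    ∑ j, Real.exp (ℓ j θ) *
      (inner ℝ (∇ (ℓ j) θ) h ^ 2 + inner ℝ h (fderiv ℝ (∇ (ℓ j)) θ h)) = 0 := by
  have hderiv : HasFDerivAt
      (fun θ => ∑ j, Real.exp (ℓ j θ) * innerSL ℝ h (∇ (ℓ j) θ)) _ θ :=
    .fun_sum fun j _ =>
      (differentiableAt_of_contDiffOn_two hU (hℓ j) hθ).hasGradientAt.hasFDerivAt.exp.mul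
        ((innerSL ℝ h).hasFDerivAt.comp θ (differentiableAt_gradient hU (hℓ j) hθ).hasFDerivAt)
  have hconst : (fun θ => ∑ j, Real.exp (ℓ j θ) * innerSL ℝ h (∇ (ℓ j) θ)) =ᶠ[𝓝 θ]
      fun _ => 0 := by
    filter_upwards [hU.mem_nhds hθ] with θ' hθ'
    exact sum_exp_mul_inner_gradient
      (fun j => differentiableAt_of_contDiffOn_two hU (hℓ j) hθ')
      (mem_of_superset (hU.mem_nhds hθ') hsum) h
  have hzero := hderiv.unique ((hasFDerivAt_const (0 : ℝ) θ).congr_of_eventuallyEq hconst)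
  have happly := congrArg (fun L => L h) hzero
  simp only [sum_apply, zero_apply, add_apply, smul_apply, ContinuousLinearMap.comp_apply,
    innerSL_apply_apply, InnerProductSpace.toDual_apply_apply, smul_eq_mul] at happly
  rw [← happly]
  refine Finset.sum_congr rfl fun j _ => ?_
  rw [real_inner_comm h]
  ring

end Bartlett

lemma isProbabilityMeasure_errorLaw {K : ℕ} {f : (Fin K → ℝ) → ℝ} (hf : IsErrorDensity f) :
    IsProbabilityMeasure (errorLaw f) :=
  ⟨by rw [errorLaw, withDensity_apply _ MeasurableSet.univ, Measure.restrict_univ,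
    hf.lintegral_eq_one]⟩

lemma measurable_latentUtility {K : ℕ} (v : Fin K → ℝ) (S : Matrix (Fin K) (Fin K) ℝ)
    (j : Fin K) : Measurable fun e => latentUtility v S e j := by
  unfold latentUtility
  exact (Continuous.matrix_mulVec continuous_const continuous_id).measurable.eval.const_add _

lemma sum_choiceProb_eq_one {K : ℕ} [Nonempty (Fin K)] {f : (Fin K → ℝ) → ℝ}
    (hf : IsErrorDensity f) {v : Fin K → ℝ} {S : Matrix (Fin K) (Fin K) ℝ}
    (hties : ∀ j k, j ≠ k → ∀ᵐ e ∂errorLaw f, latentUtility v S e j ≠ latentUtility v S e k) :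
    ∑ j, choiceProb f v S j = 1 := by
  have := isProbabilityMeasure_errorLaw hf
  set A : Fin K → Set (Fin K → ℝ) := fun j =>
    {e | ∀ k, k ≠ j → latentUtility v S e k ≤ latentUtility v S e j}
  have hmeas (j : Fin K) : MeasurableSet (A j) := by
    simp only [A, Set.ofPred_forall]
    exact .iInter fun k => .iInter fun _ =>
      measurableSet_le (measurable_latentUtility v S k) (measurable_latentUtility v S j)
  have hdisj : Pairwise (Function.onFun (AEDisjoint (errorLaw f)) A) := by
    refine fun j k hjk => measure_mono_null ?_ (ae_iff.mp (hties j k hjk))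
    rintro e ⟨hj, hk⟩
    exact not_not.mpr (le_antisymm (hk j hjk) (hj k hjk.symm))
  have hunion : ⋃ j, A j = Set.univ := by
    refine Set.eq_univ_of_forall fun e => ?_
    obtain ⟨j, hj⟩ := Finite.exists_max fun j => latentUtility v S e j
    exact Set.mem_iUnion.mpr ⟨j, fun k _ => hj k⟩
  calc ∑ j, (errorLaw f).real (A j) = (errorLaw f).real (⋃ j, A j) := by
        simp only [Measure.real, measure_iUnion₀ hdisj fun j => (hmeas j).nullMeasurableSet,
          tsum_fintype, ENNReal.toReal_sum fun j _ => measure_ne_top (errorLaw f) (A j)]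
    _ = 1 := by rw [hunion, probReal_univ]

namespace ChoiceModel

variable {K p : ℕ} {𝒳 : Type*} [MeasurableSpace 𝒳] {M : ChoiceModel K p 𝒳}
  {Θ : Set (EuclideanSpace ℝ (Fin p))} {θ θ₀ : EuclideanSpace ℝ (Fin p)}

lemma IsProper.exp_logLik (hM : M.IsProper Θ) (hθ : θ ∈ Θ) (x : 𝒳) (j : Fin K) :
    Real.exp (M.logLik (x, j) θ) = M.prob x θ j :=
  Real.exp_log (hM.prob_pos x θ hθ j)

lemma IsProper.sum_exp_logLik [Nonempty (Fin K)] (hM : M.IsProper Θ) (hθ : θ ∈ Θ) (x : 𝒳) :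
    ∑ j, Real.exp (M.logLik (x, j) θ) = 1 := by
  simp_rw [hM.exp_logLik hθ]
  exact sum_choiceProb_eq_one hM.errorDensity (hM.no_ties x θ hθ)

lemma IsProper.logLik_nonpos (hM : M.IsProper Θ) (z : 𝒳 × Fin K) (θ : EuclideanSpace ℝ (Fin p)) :
    M.logLik z θ ≤ 0 := by
  have := isProbabilityMeasure_errorLaw hM.errorDensity
  exact Real.log_nonpos measureReal_nonneg measureReal_le_one

lemma IsProper.measurable_logLik (hM : M.IsProper Θ) (hθ : θ ∈ Θ) :
    Measurable fun z => M.logLik z θ :=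
  measurable_from_prod_countable_left fun j => (hM.prob_measurable θ hθ j).log

lemma IsProper.integral_observationLaw {Q : Measure 𝒳} (hM : M.IsProper Θ) (hθ : θ ∈ Θ)
    {F : 𝒳 × Fin K → ℝ} (hF : Integrable F (M.observationLaw Q θ)) :
    ∫ z, F z ∂M.observationLaw Q θ = ∫ x, ∑ j, M.prob x θ j * F (x, j) ∂Q := by
  have hweight (j : Fin K) : Measurable fun x => ENNReal.ofReal (M.prob x θ j) :=
    (hM.prob_measurable θ hθ j).ennreal_ofReal
  have hfinite (j : Fin K) : ∀ᵐ x ∂Q, ENNReal.ofReal (M.prob x θ j) < ∞ :=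
    ae_of_all _ fun _ => ENNReal.ofReal_lt_top
  have hprob (x : 𝒳) (j : Fin K) : (ENNReal.ofReal (M.prob x θ j)).toReal = M.prob x θ j :=
    ENNReal.toReal_ofReal (hM.prob_pos x θ hθ j).le
  rw [observationLaw, integrable_finsetSum_measure] at hF
  have hmeas (j : Fin K) := (hF j (Finset.mem_univ j)).aestronglyMeasurable
  have hslice (j : Fin K) : Integrable (fun x => M.prob x θ j * F (x, j)) Q := by
    simpa [Function.comp_def, hprob] using
      (integrable_withDensity_iff_integrable_smul' (hweight j) (hfinite j)).mp
        ((integrable_map_measure (hmeas j) measurable_prodMk_right.aemeasurable).mp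
          (hF j (Finset.mem_univ j)))
  rw [observationLaw, integral_finsetSum_measure hF, integral_finsetSum _ fun j _ => hslice j]
  refine Finset.sum_congr rfl fun j _ => ?_
  rw [integral_map measurable_prodMk_right.aemeasurable (hmeas j),
    integral_withDensity_eq_integral_toReal_smul (hweight j) (hfinite j)]
  simp only [hprob, smul_eq_mul]

lemma IsRegular.memLp_score {D : Measure (𝒳 × Fin K)} (hR : M.IsRegular Θ D θ₀)
    (hM : M.IsProper Θ) : MemLp (fun z => M.score z θ₀) 2 D := by
  have hmeas : Measurable fun z => M.score z θ₀ := measurable_gradient_of_contDiffOn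
    isOpen_interior (fun _ hθ => hM.measurable_logLik (interior_subset hθ)) hR.contDiffOn
    hR.mem_interior
  refine ⟨hmeas.aestronglyMeasurable, ?_⟩
  rw [eLpNorm_lt_top_iff_lintegral_rpow_enorm_lt_top two_ne_zero ENNReal.ofNat_ne_top]
  refine (lintegral_mono fun z => ?_).trans_lt hR.score_bound
  simpa using le_iSup₂ (f := fun θ (_ : θ ∈ interior Θ) => ‖M.score z θ‖ₑ ^ 2) θ₀ hR.mem_interior

lemma IsRegular.isRegularCriterion {D : Measure (𝒳 × Fin K)} (hR : M.IsRegular Θ D θ₀)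
    (hM : M.IsProper Θ) : IsRegularCriterion M.logLik Θ D θ₀ where
  isCompact := hR.isCompact
  mem_interior := hR.mem_interior
  measurable _ := hM.measurable_logLik
  nonpos z θ _ := hM.logLik_nonpos z θ
  continuousOn := hR.continuousOn
  contDiffOn := hR.contDiffOn
  integrable := hR.integrable
  unique_max θ hθ hne := by
    simpa [expectedLogLik, EReal.neg_lt_neg_iff] using hR.unique_max θ hθ hne
  memLp_gradient := hR.memLp_score hM
  hessian_bound := hR.hessian_bound

lemma IsRegular.integral_inner_hessian {Q : Measure 𝒳}
    (hR : M.IsRegular Θ (M.observationLaw Q θ₀) θ₀) (hM : M.IsProper Θ)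
    (t : EuclideanSpace ℝ (Fin p)) :
    ∫ z, inner ℝ t (M.hessian z θ₀ t) ∂M.observationLaw Q θ₀ =
      -(t.ofLp ⬝ᵥ (M.fisherInfo (M.observationLaw Q θ₀) θ₀).mulVec t.ofLp) := by
  have hθ₀ := interior_subset hR.mem_interior
  have hscore : Integrable (fun z => inner ℝ (M.score z θ₀) t ^ 2) (M.observationLaw Q θ₀) :=
    ((hR.memLp_score hM).inner_const t).integrable_sq
  have hhess : Integrable (fun z => inner ℝ t (M.hessian z θ₀ t)) (M.observationLaw Q θ₀) :=
    ((hR.isRegularCriterion hM).integrable_hessian.apply_continuousLinearMap t).const_inner t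
  have hcond (x : 𝒳) : ∑ j, M.prob x θ₀ j *
      (inner ℝ (M.score (x, j) θ₀) t ^ 2 + inner ℝ t (M.hessian (x, j) θ₀ t)) = 0 := by
    cases isEmpty_or_nonempty (Fin K)
    · exact Fintype.sum_empty _
    simp_rw [← hM.exp_logLik hθ₀]
    exact sum_exp_mul_inner_gradient_sq_add_hessian isOpen_interior
      (fun j => hR.contDiffOn (x, j)) (fun θ hθ => hM.sum_exp_logLik (interior_subset hθ) x)
      hR.mem_interior t
  have hzero := hM.integral_observationLaw hθ₀ (hscore.add hhess)
  simp only [Pi.add_apply, hcond, integral_zero] at hzero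
  rw [integral_add hscore hhess, integral_inner_sq_eq_secondMoment (hR.memLp_score hM)] at hzero
  exact eq_neg_of_add_eq_zero_right hzero

end ChoiceModel

theorem theorem4_general {Ω 𝒵 ι : Type*} [MeasurableSpace Ω] [MeasurableSpace 𝒵] [Fintype ι]
    [DecidableEq ι] {m : 𝒵 → EuclideanSpace ℝ ι → ℝ} {Θ : Set (EuclideanSpace ℝ ι)}
    {θ₀ : EuclideanSpace ℝ ι} {Z : ℕ → Ω → 𝒵} {μ : Measure Ω} [IsProbabilityMeasure μ]
    {D : Measure 𝒵} {H : Matrix ι ι ℝ} (hindep : iIndepFun Z μ) (hlaw : ∀ i, HasLaw (Z i) D μ)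
    (hm : IsRegularCriterion m Θ D θ₀) (hH : H.PosDef)
    (hmean : ∀ t : EuclideanSpace ℝ ι,
      ∫ z, inner ℝ t (fderiv ℝ (∇ (m z)) θ₀ t) ∂D = -(t.ofLp ⬝ᵥ H.mulVec t.ofLp))
    {L : ℕ → Ω → EuclideanSpace ℝ ι → ℝ} {α : ℝ} (hα : 1 ≤ α)
    (happrox : IsLittleOInProb μ (fun n ω => ⨆ θ ∈ Θ, ENNReal.ofReal
      |L n ω θ - (∑ i ∈ Finset.range n, m (Z i ω) θ) / n|) (fun n => (n : ℝ) ^ (-α)))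
    {θhat : ℕ → Ω → EuclideanSpace ℝ ι} (hmeas : ∀ n, AEMeasurable (θhat n) μ)
    (hmem : ∀ n, ∀ᵐ ω ∂μ, θhat n ω ∈ Θ)
    (hmax : IsLittleOInProb μ
      (fun n ω => ⨆ θ ∈ Θ, ENNReal.ofReal (L n ω θ - L n ω (θhat n ω))) (fun n => (n : ℝ)⁻¹)) :
    TendstoInDistribution (fun (n : ℕ) ω => √(n : ℝ) • (θhat n ω - θ₀)) atTop id (fun _ => μ)
      (multivariateGaussian 0 (H⁻¹ * secondMoment (fun z => ∇ (m z) θ₀) D * H⁻¹)) := by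
  have : IsFiniteMeasure D := (hlaw 0).isFiniteMeasure_iff.mp inferInstance
  refine tendstoInDistribution_near_argmax_sampleMean hindep hlaw hm hH hmean hmeas hmem
    fun κ hκ => ?_
  simp only [sampleMean, smul_eq_mul, inv_mul_eq_div]
  exact eventually_near_argmax_of_isLittleOInProb hα happrox hmem hmax hκ

/-- Observations `Z i = (X_i, y_i)`; an emulator `Phat v Σ φ` with (possibly random) trained weights
`φ n`; `θhat n` maximizes the emulator log-likelihood over `Θ` up to an error `o_p(n⁻¹)`, which is
zero for an exact maximizer. -/
theorem theorem4 {K p : ℕ} {𝒳 Ω Φ : Type*} [MeasurableSpace 𝒳] [MeasurableSpace Ω]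
    (μ : Measure Ω) [IsProbabilityMeasure μ]
    (M : ChoiceModel K p 𝒳) (Θ : Set (EuclideanSpace ℝ (Fin p)))
    (θ₀ : EuclideanSpace ℝ (Fin p)) (Q : Measure 𝒳) [IsProbabilityMeasure Q]
    (hproper : M.IsProper Θ)
    (hregular : M.IsRegular Θ (M.observationLaw Q θ₀) θ₀)
    (Z : ℕ → Ω → 𝒳 × Fin K)
    (hindep : iIndepFun Z μ)
    (hlaw : ∀ i, HasLaw (Z i) (M.observationLaw Q θ₀) μ)
    (Phat : (Fin K → ℝ) → Matrix (Fin K) (Fin K) ℝ → Φ → Fin K → ℝ)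
    (φ : ℕ → Ω → Φ)
    (hPhat : ∀ n ω x, ∀ θ ∈ Θ, ∀ j, 0 < Phat (M.utility x θ) (M.scale x θ) (φ n ω) j)
    (α : ℝ) (hα : 1 ≤ α)
    (happrox : IsLittleOInProb μ
      (fun n ω => ⨆ θ ∈ Θ, ENNReal.ofReal
        |M.emulatorAvgLogLik (fun v S => Phat v S (φ n ω)) n (fun i => Z i ω) θ
          - M.avgLogLik n (fun i => Z i ω) θ|)
      (fun n => (n : ℝ) ^ (-α)))
    (θhat : ℕ → Ω → EuclideanSpace ℝ (Fin p))
    (hmeas : ∀ n, AEMeasurable (θhat n) μ)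
    (hmem : ∀ n, ∀ᵐ ω ∂μ, θhat n ω ∈ Θ)
    (hmax : IsLittleOInProb μ
      (fun n ω => ⨆ θ ∈ Θ, ENNReal.ofReal
        (M.emulatorAvgLogLik (fun v S => Phat v S (φ n ω)) n (fun i => Z i ω) θ
          - M.emulatorAvgLogLik (fun v S => Phat v S (φ n ω)) n (fun i => Z i ω) (θhat n ω)))
      (fun n => (n : ℝ)⁻¹)) :
    TendstoInDistribution (fun (n : ℕ) ω => √(n : ℝ) • (θhat n ω - θ₀)) atTop id
      (fun _ => μ)
      (multivariateGaussian 0 (M.fisherInfo (M.observationLaw Q θ₀) θ₀)⁻¹) := by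
  rw [← one_mul (M.fisherInfo _ _)⁻¹, ← Matrix.nonsing_inv_mul _
    ((Matrix.isUnit_iff_isUnit_det _).mp hregular.fisherInfo_posDef.isUnit)]
  exact theorem4_general hindep hlaw (hregular.isRegularCriterion hproper)
    hregular.fisherInfo_posDef (hregular.integral_inner_hessian hproper) hα happrox hmeas hmem hmax
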